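/- **Setting.** Let $0<i_0<n-1$, $m=n-i_0-1$, and split $\mathbb R^{n+1}=\mathbb R^{m}\oplus\mathbb R\oplus\mathbb R^{i_0}\oplus\mathbb R$. Let $\mathbb S^n$ be the sphere of rays in $\mathbb R^{n+1}$, and $\mathbf v=[0,\dots,0,1]$. Let $\mathbb S^{n-i_0-2}$, $\mathbb S^{i_0}_\infty$ and $\mathbb S^{i_0+1}_k$ be the great spheres given respectively by the vanishing of all coordinates outside the first $m$, of the first $m+1$ coordinates, and of the first $m$ coordinates. Let $H$ be the open hemisphere $x_{m+1}>0$, and $\Pi_K:\mathbb S^n-\mathbb S^{i_0}_\infty\to\mathbb S^{m}$ the projection to the first $m+1$ coordinates. A set in a sphere is *properly convex* if it is convex and its closure contains no antipodal pair. Let $\mathcal O=\tilde{\mathcal O}/\Gamma$ be a properly convex real projective $n$-orbifold: $\tilde{\mathcal O}\subset\mathbb S^n$ is properly convex and $\Gamma\subset \mathrm{SL}_\pm(n+1,\mathbb R)$ preserves it and acts properly discontinuously on it. Let $\tilde E$ be a radial pseudo-end with vertex $\mathbf v$, with fundamental group $G\subset\Gamma$, and with compact end orbifold $\tilde\Sigma/G$,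 where $\tilde\Sigma$ is the domain of directions at $\mathbf v$. A *p-end neighborhood* of $\tilde E$ is a connected open set $U\subset\tilde{\mathcal O}$, foliated by open segments ending at $\mathbf v$ whose directions form exactly $\tilde\Sigma$, with $g(U)=U$ for $g\in G$ and $\gamma(U)\cap U=\emptyset$ for $\gamma\in\Gamma-G$. Assume that $\tilde\Sigma$ is the union of complete affine $i_0$-dimensional leaves $\Pi_K^{-1}(K^o)$, where $K=K''*k$ is the strict join of a properly convex domain $K''\subset\mathbb S^{n-i_0-2}$ and $k=[0,\dots,0,1]\in\mathbb S^m$, and that $K^o/G$ is compact. Let $U$ be a p-end neighborhood of $\tilde E$. For $g\in G$ let $\bar\lambda(g)$ be the largest norm of its eigenvalues, $\lambda_2(g)$ the second largest norm, $\lambda_{\mathbf v}(g)$ its eigenvalue at $\mathbf v$, and $\lambda_1(g)$ the largest norm $r$ such that the sum of the real Jordan subspaces for eigenvalues of norm $r$ contains a vector $v$ with $[v]\notin\mathbb S^{i_0}_\infty$. Assume: * (weak middle-eigenvalue condition) $\bar\lambda(g)\ge\lambda_1(g)\ge\lambda_{\mathbf v}(g)$ for all $g\in G$. * Every $g\in G$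 has the form $$g=\begin{pmatrix}S(g)&0&0&0\\0&a_1(g)&0&0\\0&a_4(g)&a_5(g)O_5(g)&0\\0&a_7(g)&a_8(g)&a_9(g)\end{pmatrix},\qquad O_5(g)\in O(i_0),\ a_5(g)>0,$$ and $\mu_g=a_5(g)/a_1(g)=1$; so $a_9(g)=\lambda_{\mathbf v}(g)$. * $G$ normalizes the group $\mathcal N=\{\mathcal N(\vec v):\vec v\in\mathbb R^{i_0}\}$, and $\mathcal N$ preserves $U$, where $$\mathcal N(\vec v)=\begin{pmatrix}I&0&0&0\\0&1&0&0\\0&\vec v^{T}&I&0\\0&\tfrac12\|\vec v\|^2&\vec v&1\end{pmatrix}.$$ Put $\vec v_g=a_4(g)/\lambda_{\mathbf v}(g)$ and $\alpha_7(g)=a_7(g)/\lambda_{\mathbf v}(g)-\tfrac12\|\vec v_g\|^2$. Let $G_+$ be the set of $g\in G$ with $\bar\lambda(g)=\lambda_{\mathbf v}(g)$ all of whose eigenvalues on $K''$ (those of $S(g)$) have norm $<\lambda_{\mathbf v}(g)$, and for $g\in G_+$ put $\mu_7(g)=\alpha_7(g)/\log\frac{\lambda_{\mathbf v}(g)}{\lambda_2(g)}$.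 The *uniform positive translation condition* says that there is a constant $C_0>0$ with $\mu_7(g)>C_0$ for all $g\in G_+$. A set is a *join* if it is the interior of the join of a properly convex domain of $\mathbb S^{n-i_0-2}$ and a properly convex domain of $\mathbb S^{i_0+1}_k$. **Proposition (Quasi-joins).** Under these assumptions: 1. If $G$ acts on a properly convex domain in $H$, then $\alpha_7(g)\ge0$ for every $g\in G_+$. 2. The uniform positive translation condition holds if and only if $\tilde E$ has a properly convex p-end neighborhood $U'$ whose closure meets $\mathbb S^{i_0+1}_k$ only at $\mathbf v$. 3. If $U$ is convex, then $\alpha_7\equiv0$ on $G$ if and only if $U$ is a join and is properly convex. For general $U$, $\alpha_7\equiv0$ on $G$ if and only if $\tilde E$ has a properly convex p-end neighborhood that is a join. -/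

import Mathlib

open scoped Matrix

namespace QJoin

/-! Subsets of the projective sphere `S(E) = (E - 0) / ℝ_{>0}` are encoded throughout by the
cones of their representatives in `E`: a subset of `S(E)` is a set of nonzero vectors stable under
positive scalars, it is open in `S(E)` iff the cone is open in `E`, and its closure in
`S(E)` is the closure of the cone with the origin removed. -/

/-- A (nonempty) properly convex subset of the sphere `S(E)`: convex, and its closure contains no
pair of antipodal points. -/
structure IsProperlyConvex {E : Type*} [AddCommGroup E] [Module ℝ E] [TopologicalSpace E]
    (A : Set E) : Prop where
  nonempty : A.Nonempty
  zero_notMem : (0 : E) ∉ A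
  smul_mem : ∀ x ∈ A, ∀ s : ℝ, 0 < s → s • x ∈ A
  convex : Convex ℝ A
  no_antipodal : ∀ x ∈ closure A, -x ∈ closure A → x = 0

/-- A properly convex domain of `S(E)`. -/
def IsProperlyConvexDomain {E : Type*} [AddCommGroup E] [Module ℝ E] [TopologicalSpace E]
    (A : Set E) : Prop :=
  IsOpen A ∧ IsProperlyConvex A

/-- Coordinates of `ℝ^{n+1}` for `n = m + i + 1`, in blocks of sizes `m = n - i - 1`, `1`, `i`, `1`.
Here `i` is the fiber dimension of the end. -/
abbrev Idx (m i : ℕ) : Type := Fin m ⊕ Unit ⊕ Fin i ⊕ Unit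

/-- The ambient space `ℝ^{n+1}`. -/
abbrev Vec (m i : ℕ) : Type := Idx m i → ℝ

variable {m i : ℕ}

/-- first block: the coordinates `1, …, n - i - 1` -/
def iK (a : Fin m) : Idx m i := Sum.inl a
/-- second block: the coordinate `n - i` -/
def iO : Idx m i := Sum.inr (Sum.inl ())
/-- third block: the coordinates `n - i + 1, …, n` -/
def iX (j : Fin i) : Idx m i := Sum.inr (Sum.inr (Sum.inl j))
/-- fourth block: the last coordinate `n + 1` -/
def iV : Idx m i := Sum.inr (Sum.inr (Sum.inr ()))

/-- The first block of coordinates of a vector. -/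
def partK (x : Vec m i) : Fin m → ℝ := fun a => x (Sum.inl a)
/-- The last three blocks of coordinates of a vector: a vector of the subspace spanned by
`S^{i+1}_k`, which is cut out by `partK x = 0`. -/
def partW (x : Vec m i) : Unit ⊕ Fin i ⊕ Unit → ℝ := fun a => x (Sum.inr a)

/-- The p-end vertex `[0, …, 0, 1]`. -/
def vtx : Vec m i := Pi.single iV 1

/-- The line spanned by the vertex. -/
def vtxLine (m i : ℕ) : Set (Vec m i) := {x | ∃ t : ℝ, x = t • vtx}

/-- The vector subspace of `S^i_∞`: the first `n - i` coordinates vanish. -/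
def vInf (m i : ℕ) : Set (Vec m i) := {x | partK x = 0 ∧ x iO = 0}

/-- The great sphere `S^{i+1}_k` corresponding to the vertex `k = [0, …, 0, 1]` of `K`. -/
def sphereK (m i : ℕ) : Set (Vec m i) := {x | x ≠ 0 ∧ partK x = 0}

/-- The open hemisphere `H`, given by `x_{n-i} > 0`. -/
def hemisphere (m i : ℕ) : Set (Vec m i) := {x | 0 < x iO}

/-- The image of a set under a linear projective automorphism. -/
def act (g : Matrix (Idx m i) (Idx m i) ℝ) (A : Set (Vec m i)) : Set (Vec m i) :=
  (fun x => g *ᵥ x) '' A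

/-! ### Blocks of a matrix -/

section Blocks

variable (g : Matrix (Idx m i) (Idx m i) ℝ)

def bS : Matrix (Fin m) (Fin m) ℝ := Matrix.of fun a b => g (iK a) (iK b)
def a1 : ℝ := g iO iO
def a4 : Fin i → ℝ := fun j => g (iX j) iO
def A5 : Matrix (Fin i) (Fin i) ℝ := Matrix.of fun j k => g (iX j) (iX k)
def a7 : ℝ := g iV iO

/-- The eigenvalue at the vertex, the entry `a_9`. -/
noncomputable def lamV : ℝ := g iV iV

/-- `a_5 = |det A_5|^{1/i}` -/
noncomputable def a5 : ℝ := |(A5 g).det| ^ ((1 : ℝ) / (i : ℝ))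

/-- `μ_g = a_5 / a_1` -/
noncomputable def mu : ℝ := a5 g / a1 g

/-- The matrix `g` has the block form
```
S    0    0       0
0    a_1  0       0
0    a_4  a_5 O_5 0
0    a_7  a_8     a_9
```
with `O_5` orthogonal (so the blocks `s_1`, `s_2`, `C_1`, `c_2` vanish). -/
structure IsBlockForm : Prop where
  K_O : ∀ a : Fin m, g (iK a) iO = 0
  K_X : ∀ (a : Fin m) (j : Fin i), g (iK a) (iX j) = 0
  K_V : ∀ a : Fin m, g (iK a) iV = 0
  O_K : ∀ a : Fin m, g iO (iK a) = 0
  O_X : ∀ j : Fin i, g iO (iX j) = 0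
  O_V : g iO iV = 0
  X_K : ∀ (j : Fin i) (a : Fin m), g (iX j) (iK a) = 0
  X_V : ∀ j : Fin i, g (iX j) iV = 0
  V_K : ∀ a : Fin m, g iV (iK a) = 0
  orth : (a5 g)⁻¹ • A5 g ∈ Matrix.orthogonalGroup (Fin i) ℝ

/-- The vector `v_g` with `a_4(g) = λ_v(g) v_g`. -/
noncomputable def vecOf : Fin i → ℝ := fun j => a4 g j / lamV g

/-- `α_7(g) = a_7(g) / λ_v(g) - ‖v_g‖² / 2` -/
noncomputable def alpha7 : ℝ := a7 g / lamV g - (∑ j, vecOf g j ^ 2) / 2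

end Blocks

/-- The element `𝒩(v)` of the standard cusp group, with vanishing blocks `C_1(v)`, `c_2(v)`:
```
I   0         0   0
0   1         0   0
0   vᵀ        I   0
0   ‖v‖²/2    v   1
``` -/
noncomputable def cusp (v : Fin i → ℝ) : Matrix (Idx m i) (Idx m i) ℝ :=
  Matrix.of fun r c =>
    match r, c with
    | Sum.inr (Sum.inr (Sum.inl j)), Sum.inr (Sum.inl _) => v j
    | Sum.inr (Sum.inr (Sum.inr _)), Sum.inr (Sum.inl _) => (∑ j, v j ^ 2) / 2
    | Sum.inr (Sum.inr (Sum.inr _)), Sum.inr (Sum.inr (Sum.inl j)) => v j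
    | r, c => (1 : Matrix (Idx m i) (Idx m i) ℝ) r c

/-! ### Eigenvalues -/

/-- The norms of the complex eigenvalues of a real matrix. -/
def eigNorms {ι : Type*} [Fintype ι] [DecidableEq ι] (A : Matrix ι ι ℝ) : Set ℝ :=
  {r | ∃ z ∈ spectrum ℂ (A.map (algebraMap ℝ ℂ)), r = ‖z‖}

/-- The largest norm of an eigenvalue. -/
noncomputable def maxEigNorm {ι : Type*} [Fintype ι] [DecidableEq ι] (A : Matrix ι ι ℝ) : ℝ :=
  sSup (eigNorms A)

/-- The second largest norm of an eigenvalue, `λ_2`. -/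
noncomputable def secondEigNorm {ι : Type*} [Fintype ι] [DecidableEq ι]
    (A : Matrix ι ι ℝ) : ℝ :=
  sSup {r ∈ eigNorms A | r < maxEigNorm A}

/-- `x` is affiliated with the norm `r`: it lies in the (real part of the) sum of all the
Jordan subspaces of the eigenvalues of norm `r`. -/
def Affiliated (g : Matrix (Idx m i) (Idx m i) ℝ) (r : ℝ) (x : Vec m i) : Prop :=
  (fun a => (x a : ℂ)) ∈
    ⨆ z ∈ {z : ℂ | ‖z‖ = r},
      Module.End.maxGenEigenspace (Matrix.toLin' (g.map (algebraMap ℝ ℂ))) z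

/-- `λ_1(g)`: the largest norm of an eigenvalue affiliated with a point outside `S^i_∞`. -/
noncomputable def lam1 (g : Matrix (Idx m i) (Idx m i) ℝ) : ℝ :=
  sSup {r | ∃ x : Vec m i, x ∉ vInf m i ∧ Affiliated g r x}

/-- `λ_{K''}(g)`: the largest norm of an eigenvalue occurring on `K''`. -/
noncomputable def lamK (g : Matrix (Idx m i) (Idx m i) ℝ) : ℝ := maxEigNorm (bS g)

/-- The weak middle-eigenvalue condition: `λ̄(g) ≥ λ_1(g) ≥ λ_v(g)` on `G`. -/
def WeakMiddleEigenvalue (G : Subgroup (GL (Idx m i) ℝ)) : Prop :=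
  ∀ g ∈ G, lam1 g.val ≤ maxEigNorm g.val ∧ lamV g.val ≤ lam1 g.val

/-- `G_+`: the elements whose largest eigenvalue norm occurs at the vertex `k` (where it equals
`λ_v`), all the norms occurring on `K''` being strictly smaller. -/
def Gplus (G : Subgroup (GL (Idx m i) ℝ)) : Set (GL (Idx m i) ℝ) :=
  {g | g ∈ G ∧ maxEigNorm g.val = lamV g.val ∧ lamK g.val < lamV g.val}

/-- `μ_7(g) = α_7(g) / log (λ_v(g) / λ_2(g))`, used on `G_+` only. -/
noncomputable def mu7 (g : Matrix (Idx m i) (Idx m i) ℝ) : ℝ :=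
  alpha7 g / Real.log (lamV g / secondEigNorm g)

/-- The nonnegative translation condition. -/
def NonnegTranslation (G : Subgroup (GL (Idx m i) ℝ)) : Prop :=
  ∀ g ∈ Gplus G, 0 ≤ alpha7 g.val

/-- The uniform positive translation condition. -/
def UniformPosTranslation (G : Subgroup (GL (Idx m i) ℝ)) : Prop :=
  ∃ C₀ : ℝ, 0 < C₀ ∧ ∀ g ∈ Gplus G, C₀ < mu7 g.val

/-! ### Properly convex orbifolds and their ends -/

/-- `Õ / Γ` is a properly convex real projective orbifold: `Γ ≤ SL_±(n+1, ℝ)` acts properly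
discontinuously on the properly convex `Õ ⊆ S^n`. -/
structure IsProperlyConvexOrbifold (Otilde : Set (Vec m i))
    (Γ : Subgroup (GL (Idx m i) ℝ)) : Prop where
  properlyConvex : IsProperlyConvex Otilde
  det_eq : ∀ γ ∈ Γ, |γ.val.det| = 1
  invariant : ∀ γ ∈ Γ, act γ.val Otilde = Otilde
  properlyDiscontinuous : ∀ J ⊆ Otilde, IsCompact J →
    {γ | γ ∈ Γ ∧ ∃ x ∈ J, ∃ s : ℝ, 0 < s ∧ s • (γ.val *ᵥ x) ∈ J}.Finite

/-- The (vectors representing the) directions at the vertex of the radial lines in `U`: a subset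
of the linking sphere `S(ℝ^{n+1} / ℝ v)`, encoded by its preimage in `ℝ^{n+1}`. -/
def directions (U : Set (Vec m i)) : Set (Vec m i) := {w | ∃ t : ℝ, w + t • vtx ∈ U}

/-- The universal cover `Σ̃` of the end orbifold. Let `Ω` be (the cone of) the interior of `K''`;
then `{(κ, s) | κ ∈ Ω, s > 0}` is the interior `K°` of the strict join `K = K'' * k`, and `Σ̃` is
`Π_K⁻¹(K°)`, the union of the complete affine `i`-dimensional leaves over the points of `K°`. -/
def linkDomain (Ω : Set (Fin m → ℝ)) : Set (Vec m i) := {w | partK w ∈ Ω ∧ 0 < w iO}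

/-- `U` is a p-end neighborhood in `Õ` of the radial p-end with vertex `vtx`, p-end fundamental
group `G` and `Σ̃ = linkDomain Ω`: a connected open set foliated by segments ending at
the vertex, in the directions `Σ̃`, which is `G`-invariant and disjoint from its other
translates under `Γ` (it is a component of the inverse image of an end neighborhood). -/
structure IsPEndNbhd (Otilde : Set (Vec m i)) (Γ G : Subgroup (GL (Idx m i) ℝ))
    (Ω : Set (Fin m → ℝ)) (U : Set (Vec m i)) : Prop where
  isOpen : IsOpen U
  connected : IsConnected U
  zero_notMem : (0 : Vec m i) ∉ U
  smul_mem : ∀ x ∈ U, ∀ s : ℝ, 0 < s → s • x ∈ U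
  subset : U ⊆ Otilde
  radial : ∀ x ∈ U, ∀ t : ℝ, 0 ≤ t → x + t • vtx ∈ U
  directions_eq : directions U = linkDomain Ω
  invariant : ∀ g ∈ G, act g.val U = U
  disjoint : ∀ γ ∈ Γ, γ ∉ G → Disjoint (act γ.val U) U

/-- `A`, the preimage in `ℝ^{n+1}` of a subset of the sphere `S(ℝ^{n+1} / W)`, is the union
of the `G`-translates of a compact set: its quotient by `G` is compact. -/
def CocompactOn (G : Subgroup (GL (Idx m i) ℝ)) (W A : Set (Vec m i)) : Prop :=
  ∃ J ⊆ A, IsCompact J ∧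
    ∀ w ∈ A, ∃ g ∈ G, ∃ z ∈ J, ∃ s : ℝ, 0 < s ∧ w - s • (g.val *ᵥ z) ∈ W

/-- `U` is (the interior of) the join of a properly convex domain `A` of `S^{n-i-2}` and a properly
convex domain `B` of `S^{i+1}_k`, i.e. the set of all `[a + b]` with `[a] ∈ A`, `[b] ∈ B`. -/
def IsJoin (U : Set (Vec m i)) : Prop :=
  ∃ (A : Set (Fin m → ℝ)) (B : Set (Unit ⊕ Fin i ⊕ Unit → ℝ)),
    IsProperlyConvexDomain A ∧ IsProperlyConvexDomain B ∧ U = {x | partK x ∈ A ∧ partW x ∈ B}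

end QJoin

/-!
# Quasi-joined ends

Normalizing the cusp group forces every `g ∈ G` to have `a_1 = a_5 = a_9 = λ_v` and
`a_8 = O_5ᵀ v_g` (`IsCuspNormalizing.mulVec_horo`). In the affine chart `x_{n-i} = 1`, with
horospherical coordinates `(κ, y, c)`, where `c = t - ‖y‖² / 2`, the element `g` therefore acts by
`κ ↦ S κ / λ_v`, `y ↦ v_g + O_5 y`, `c ↦ c + α_7`, while `𝒩(v)` only translates `y` by `v`.
A p-end neighborhood `U` invariant under the cusp group is thus the region `c > height U κ` above
the graph of a function on the open cone `Ω`, and `height U (S κ / λ_v) = height U κ + α_7(g)`.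
Since `Ω` is the cone over the interior of `K''`, on which `G` acts cocompactly, `0 ∈ closure Ω`
plays the role of the vertex `k`, and everything is read off from this function.

* Properly convex sets containing the vertex in their closures are bounded below along it
  (`exists_lower_bound`), so by cocompactness two p-end neighborhoods are nested up to the shear
  `c ↦ c + C` (`IsCuspEnd.exists_shear_subset`). Hence a sheared convex hull of `U` is a convex
  p-end neighborhood inside `U` (`IsCuspNbhd.exists_convex`).
* By cocompactness there are elements of `G` whose three components are prescribed up to a bounded
  error by a point of a leaf (`IsCuspNbhd.exists_controlled`). If `g ∈ G_+` had `α_7(g) < 0`, the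
  elements attached to the points `(S / λ_v)^n κ` of the leaf `y = 0` would drag a `G`-invariant
  convex domain towards the antipode of the vertex, and those moving far along one leaf drag it
  towards the vertex. So `α_7` is nonnegative on `G_+` as soon as there is such a domain.
* The closure of `U` meets `S^{i+1}_k` only at the vertex iff `height U` tends to infinity at `0`.
  The elements attached to points `κ` near `0` are in `G_+` with `λ_2 / λ_v = O(‖κ‖)`, so the
  uniform positive translation condition forces this. Conversely, if the height tends to infinity,
  some homothety `δ < 1` raises it by at least `1` over a compact fundamental set, hence everywhere
  as homotheties commute with `G`; so the height grows at least logarithmically in `1 / ‖κ‖` along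
  the orbit of `g ∈ G_+`, and Gelfand's formula gives the uniform positive translation condition.
* If `α_7 = 0` and `U` is convex, the height is an invariant convex function, so it attains its
  maximum over `Ω` and is constant: `U` is a join. If there is a join, the height is bounded, and
  `height U κ + n α_7(g)` bounded above for `g` and `g⁻¹` gives `α_7(g) = 0`.
-/

namespace QJoin
open Filter Topology
variable {m i : ℕ}

/-! ### Horospherical coordinates and the form of the end group -/

/-- The vector with the given blocks of coordinates. -/
def ofBlocks (κ : Fin m → ℝ) (s : ℝ) (y : Fin i → ℝ) (t : ℝ) : Vec m i :=
  Sum.elim κ (Sum.elim (fun _ => s) (Sum.elim y (fun _ => t)))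

/-- The point with horospherical coordinates `(κ, y, c)` of the affine chart `x_{n-i} = 1` of the
hemisphere `H`: the paraboloids `c = const` are invariant under the cusp group. -/
noncomputable def horo (κ : Fin m → ℝ) (y : Fin i → ℝ) (c : ℝ) : Vec m i :=
  ofBlocks κ 1 y (c + y ⬝ᵥ y / 2)

lemma vec_ext {x y : Vec m i} (hK : ∀ a, x (iK a) = y (iK a)) (hO : x iO = y iO)
    (hX : ∀ j, x (iX j) = y (iX j)) (hV : x iV = y iV) : x = y := by
  funext a
  rcases a with a | a | a | a
  exacts [hK a, hO, hX a, hV]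

@[simp] lemma ofBlocks_iK (κ : Fin m → ℝ) (s : ℝ) (y : Fin i → ℝ) (t : ℝ) (a : Fin m) :
    ofBlocks κ s y t (iK a) = κ a := rfl
@[simp] lemma ofBlocks_iO (κ : Fin m → ℝ) (s : ℝ) (y : Fin i → ℝ) (t : ℝ) :
    ofBlocks κ s y t iO = s := rfl
@[simp] lemma ofBlocks_iX (κ : Fin m → ℝ) (s : ℝ) (y : Fin i → ℝ) (t : ℝ) (j : Fin i) :
    ofBlocks κ s y t (iX j) = y j := rfl
@[simp] lemma ofBlocks_iV (κ : Fin m → ℝ) (s : ℝ) (y : Fin i → ℝ) (t : ℝ) :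
    ofBlocks κ s y t iV = t := rfl

@[simp] lemma vtx_iK (a : Fin m) : (vtx : Vec m i) (iK a) = 0 := by simp [vtx, iK, iV]
@[simp] lemma vtx_iO : (vtx : Vec m i) iO = 0 := by simp [vtx, iO, iV]
@[simp] lemma vtx_iX (j : Fin i) : (vtx : Vec m i) (iX j) = 0 := by simp [vtx, iX, iV]
@[simp] lemma vtx_iV : (vtx : Vec m i) iV = 1 := by simp [vtx]

lemma vtx_ne_zero : (vtx : Vec m i) ≠ 0 := fun h => by
  simpa using congrFun h iV

lemma eq_ofBlocks (x : Vec m i) : x = ofBlocks (partK x) (x iO) (fun j => x (iX j)) (x iV) :=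
  vec_ext (fun _ => rfl) rfl (fun _ => rfl) rfl

lemma ofBlocks_inj {κ κ' : Fin m → ℝ} {s s' : ℝ} {y y' : Fin i → ℝ} {t t' : ℝ}
    (h : ofBlocks κ s y t = ofBlocks κ' s' y' t') : κ = κ' ∧ s = s' ∧ y = y' ∧ t = t' :=
  ⟨funext fun a => congrFun h (iK a), congrFun h iO, funext fun a => congrFun h (iX a),
    congrFun h iV⟩

lemma horo_add_vtx (κ : Fin m → ℝ) (y : Fin i → ℝ) (c r : ℝ) :
    horo κ y c + r • vtx = horo κ y (c + r) := by
  refine vec_ext ?_ ?_ ?_ ?_ <;> simp [horo]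
  ring

lemma horo_inj {κ κ' : Fin m → ℝ} {y y' : Fin i → ℝ} {c c' : ℝ}
    (h : horo κ y c = horo κ' y' c') : κ = κ' ∧ y = y' ∧ c = c' := by
  obtain ⟨h1, -, h2, h3⟩ := ofBlocks_inj h
  subst h1 h2
  exact ⟨rfl, rfl, by linarith⟩

/-- The horospherical height `c` of the ray of a vector of the open hemisphere. -/
noncomputable def horoHeight (x : Vec m i) : ℝ :=
  x iV / x iO - (fun j => x (iX j) / x iO) ⬝ᵥ (fun j => x (iX j) / x iO) / 2

lemma eq_smul_horo {x : Vec m i} (hx : 0 < x iO) :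
    x = x iO • horo ((x iO)⁻¹ • partK x) (fun j => x (iX j) / x iO) (horoHeight x) := by
  refine vec_ext (fun a => ?_) ?_ (fun a => ?_) ?_ <;> simp [horo, horoHeight] <;> field_simp
  rfl

lemma mulVec_ofBlocks {g : Matrix (Idx m i) (Idx m i) ℝ} (H : IsBlockForm g)
    (κ : Fin m → ℝ) (s : ℝ) (y : Fin i → ℝ) (t : ℝ) :
    g *ᵥ ofBlocks κ s y t = ofBlocks (bS g *ᵥ κ) (a1 g * s) (s • a4 g + A5 g *ᵥ y)
      (a7 g * s + (fun j => g iV (iX j)) ⬝ᵥ y + lamV g * t) := by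
  have e : ∀ a : Idx m i, (g *ᵥ ofBlocks κ s y t) a = (∑ b, g a (iK b) * κ b) + (g a iO * s +
      ((∑ j, g a (iX j) * y j) + g a iV * t)) := fun a => by
    simp [Matrix.mulVec, dotProduct, Fintype.sum_sum_type, ofBlocks, iK, iO, iX, iV]
  refine vec_ext (fun a => ?_) ?_ (fun a => ?_) ?_ <;> rw [e]
  · simp [H.K_O, H.K_X, H.K_V, bS, Matrix.mulVec, dotProduct]
  · simp [H.O_K, H.O_X, H.O_V, a1]
  · simp [H.X_K, H.X_V, a4, A5, Matrix.mulVec, dotProduct, mul_comm]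
  · simp [H.V_K, a7, lamV, dotProduct]
    ring

lemma cusp_mulVec_ofBlocks (v : Fin i → ℝ) (κ : Fin m → ℝ) (s : ℝ) (y : Fin i → ℝ) (t : ℝ) :
    cusp v *ᵥ ofBlocks κ s y t = ofBlocks κ s (y + s • v) (t + s * (v ⬝ᵥ v / 2) + v ⬝ᵥ y) := by
  have e : ∀ a : Idx m i, (cusp v *ᵥ ofBlocks κ s y t) a = (∑ b, cusp v a (iK b) * κ b) +
      (cusp v a iO * s + ((∑ j, cusp v a (iX j) * y j) + cusp v a iV * t)) := fun a => by
    simp [Matrix.mulVec, dotProduct, Fintype.sum_sum_type, ofBlocks, iK, iO, iX, iV]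
  refine vec_ext (fun a => ?_) ?_ (fun a => ?_) ?_ <;> rw [e]
  · simp [cusp, iK, iO, iX, iV, ofBlocks, Matrix.one_apply]
  · simp [cusp, iK, iO, iX, iV, ofBlocks, Matrix.one_apply]
  · simp [cusp, iK, iO, iX, iV, ofBlocks, Matrix.one_apply]; ring
  · simp [cusp, iK, iO, iX, iV, ofBlocks, Matrix.one_apply, dotProduct, sq]; ring

lemma cusp_mulVec_horo (v : Fin i → ℝ) (κ : Fin m → ℝ) (y : Fin i → ℝ) (c : ℝ) :
    cusp v *ᵥ horo κ y c = horo κ (y + v) c := by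
  rw [horo, cusp_mulVec_ofBlocks, horo]
  congr 1
  · simp
  · simp [dotProduct_add, add_dotProduct, dotProduct_comm y v]; ring

/-- The block `S(g)`, normalized to fix the affine chart around the vertex `k`: the action of `g` on
the open cone over `K''`. -/
noncomputable def coneMap (g : Matrix (Idx m i) (Idx m i) ℝ) : Matrix (Fin m) (Fin m) ℝ :=
  (lamV g)⁻¹ • bS g

/-- The orthogonal block `O_5`. -/
noncomputable def rot (g : Matrix (Idx m i) (Idx m i) ℝ) : Matrix (Fin i) (Fin i) ℝ :=
  (a5 g)⁻¹ • A5 g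

lemma rot_dotProduct {g : Matrix (Idx m i) (Idx m i) ℝ} (H : IsBlockForm g) (x y : Fin i → ℝ) :
    (rot g *ᵥ x) ⬝ᵥ (rot g *ᵥ y) = x ⬝ᵥ y := by
  have h : (rot g)ᵀ * rot g = 1 := by
    have := (Matrix.mem_orthogonalGroup_iff' (Fin i) ℝ).1 H.orth
    simpa [Matrix.star_eq_conjTranspose, rot] using this
  rw [Matrix.dotProduct_mulVec, Matrix.vecMul_mulVec, ← Matrix.mulVec_transpose]
  simp [h]

/-- The elements of the end group: block form, `μ_g = 1`, and normalizing the cusp group. -/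
structure IsCuspNormalizing (g : Matrix (Idx m i) (Idx m i) ℝ) : Prop where
  block : IsBlockForm g
  mu_eq : mu g = 1
  normalizes : ∀ v : Fin i → ℝ, ∃ w : Fin i → ℝ, g * cusp v = cusp w * g

namespace IsCuspNormalizing
variable {g : Matrix (Idx m i) (Idx m i) ℝ} (hg : IsCuspNormalizing g)
include hg

lemma a5_eq : a5 g = a1 g := by
  have h := hg.mu_eq
  unfold mu at h
  have : a1 g ≠ 0 := fun h0 => by simp [h0] at h
  field_simp at h
  exact h

lemma a1_pos : 0 < a1 g := by
  have h := hg.mu_eq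
  unfold mu at h
  have h1 : a1 g ≠ 0 := fun h0 => by simp [h0] at h
  have h2 : 0 ≤ a5 g := Real.rpow_nonneg (abs_nonneg _) _
  rw [hg.a5_eq] at h2
  exact lt_of_le_of_ne h2 h1.symm

lemma A5_eq : A5 g = a1 g • rot g := by
  rw [rot, hg.a5_eq, smul_smul, mul_inv_cancel₀ hg.a1_pos.ne', one_smul]

/-- Comparing the two sides of `g 𝒩(v) = 𝒩(O_5 v) g` block by block: the first relation says
`a_9 = a_1`, the second one `a_8 = O_5ᵀ v_g`. -/
lemma block_relations (v : Fin i → ℝ) :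
    (∀ y, lamV g * (v ⬝ᵥ y) = a1 g * (v ⬝ᵥ y)) ∧
    (fun j => g iV (iX j)) ⬝ᵥ v + lamV g * (v ⬝ᵥ v / 2) =
      a1 g * (v ⬝ᵥ v / 2) + (rot g *ᵥ v) ⬝ᵥ a4 g := by
  obtain ⟨w, hw⟩ := hg.normalizes v
  have E : ∀ x, g *ᵥ (cusp v *ᵥ x) = cusp w *ᵥ (g *ᵥ x) := fun x => by
    rw [Matrix.mulVec_mulVec, hw, Matrix.mulVec_mulVec]
  have E1 := E (ofBlocks 0 1 0 0)
  rw [cusp_mulVec_ofBlocks, mulVec_ofBlocks hg.block, mulVec_ofBlocks hg.block,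
    cusp_mulVec_ofBlocks] at E1
  obtain ⟨-, -, h2, h3⟩ := ofBlocks_inj E1
  have hw : w = rot g *ᵥ v := by
    simp [hg.A5_eq, Matrix.smul_mulVec] at h2
    exact (smul_right_injective _ hg.a1_pos.ne' h2).symm
  subst hw
  refine ⟨fun y => ?_, ?_⟩
  · have E2 := E (ofBlocks 0 0 y 0)
    rw [cusp_mulVec_ofBlocks, mulVec_ofBlocks hg.block, mulVec_ofBlocks hg.block,
      cusp_mulVec_ofBlocks] at E2
    obtain ⟨-, -, -, h4⟩ := ofBlocks_inj E2
    simp [hg.A5_eq, Matrix.smul_mulVec, rot_dotProduct hg.block] at h4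
    rcases h4 with h4 | h4 <;> simp [h4]
  · simp [rot_dotProduct hg.block] at h3
    linarith

lemma lamV_eq (hi : 0 < i) : lamV g = a1 g := by
  have h := (hg.block_relations (Pi.single ⟨0, hi⟩ 1)).1 (Pi.single ⟨0, hi⟩ 1)
  simpa using h

lemma lamV_pos (hi : 0 < i) : 0 < lamV g := hg.lamV_eq hi ▸ hg.a1_pos

/-- In horospherical coordinates `g` is a product of the linear map `coneMap g`, a Euclidean
isometry, and the translation by `alpha7 g`. -/
lemma mulVec_horo (hi : 0 < i) (κ : Fin m → ℝ) (y : Fin i → ℝ) (c : ℝ) :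
    g *ᵥ horo κ y c =
      lamV g • horo (coneMap g *ᵥ κ) (vecOf g + rot g *ᵥ y) (c + alpha7 g) := by
  have hl := hg.lamV_pos hi
  have h1 := hg.lamV_eq hi
  have hv : a4 g = lamV g • vecOf g := by
    funext j; simp [vecOf]; field_simp
  have h8 := (hg.block_relations y).2
  rw [horo, mulVec_ofBlocks hg.block, horo]
  refine vec_ext (fun a => ?_) ?_ (fun a => ?_) ?_
  · simp [coneMap, Matrix.smul_mulVec]; field_simp
  · simp [h1]
  · simp [hv, hg.A5_eq, ← h1, Matrix.smul_mulVec, mul_add]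
  · have h7 : alpha7 g = a7 g / lamV g - (vecOf g ⬝ᵥ vecOf g) / 2 := by
      simp [alpha7, dotProduct, sq]
    simp only [ofBlocks_iV, Pi.smul_apply, smul_eq_mul, add_dotProduct, dotProduct_add, h7,
      rot_dotProduct hg.block]
    rw [hv, ← h1, dotProduct_smul, smul_eq_mul] at h8
    rw [dotProduct_comm (vecOf g) (rot g *ᵥ y)]
    field_simp
    linarith

lemma mulVec_vtx : g *ᵥ (vtx : Vec m i) = lamV g • vtx := by
  have : (vtx : Vec m i) = ofBlocks 0 0 0 1 := by
    refine vec_ext ?_ ?_ ?_ ?_ <;> simp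
  rw [this, mulVec_ofBlocks hg.block]
  refine vec_ext ?_ ?_ ?_ ?_ <;> simp

end IsCuspNormalizing

/-! ### Cocompactness and bounded distortion -/

lemma norm_sq_le_dotProduct {ι : Type*} [Fintype ι] (u : ι → ℝ) : ‖u‖ ^ 2 ≤ u ⬝ᵥ u := by
  have h0 : 0 ≤ u ⬝ᵥ u := Finset.sum_nonneg fun j _ => mul_self_nonneg _
  rw [← Real.sqrt_le_sqrt_iff h0, Real.sqrt_sq (norm_nonneg _),
    pi_norm_le_iff_of_nonneg (Real.sqrt_nonneg _)]
  intro j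
  refine Real.le_sqrt_of_sq_le ?_
  rw [Real.norm_eq_abs, sq_abs, sq]
  exact Finset.single_le_sum (f := fun j => u j * u j) (fun j _ => mul_self_nonneg _)
    (Finset.mem_univ j)

lemma norm_ofBlocks_le (κ : Fin m → ℝ) (s : ℝ) (y : Fin i → ℝ) (t : ℝ) :
    ‖ofBlocks κ s y t‖ ≤ ‖κ‖ + |s| + ‖y‖ + |t| := by
  have h0 := norm_nonneg κ
  have h1 := norm_nonneg y
  have h2 := abs_nonneg s
  have h3 := abs_nonneg t
  rw [pi_norm_le_iff_of_nonneg (by positivity)]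
  rintro (a | a | a | a)
  · have := norm_le_pi_norm κ a
    change ‖κ a‖ ≤ _; linarith
  · change ‖s‖ ≤ _; rw [Real.norm_eq_abs]; linarith
  · have := norm_le_pi_norm y a
    change ‖y a‖ ≤ _; linarith
  · change ‖t‖ ≤ _; rw [Real.norm_eq_abs]; linarith

/-- A direction that is approached by the rays of a cone belongs to the closure of the cone. -/
lemma mem_closure_of_rays {E : Type*} [NormedAddCommGroup E] [NormedSpace ℝ E] {A : Set E}
    (hA : ∀ x ∈ A, ∀ s : ℝ, 0 < s → s • x ∈ A) {u : E}
    (h : ∀ ε > 0, ∃ x ∈ A, ∃ r : ℝ, 0 < r ∧ ‖x - r • u‖ ≤ ε * r) : u ∈ closure A := by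
  rw [Metric.mem_closure_iff]
  intro ε hε
  obtain ⟨x, hx, r, hr, hxr⟩ := h (ε / 2) (by positivity)
  refine ⟨r⁻¹ • x, hA x hx _ (by positivity), ?_⟩
  have : r⁻¹ • x - u = r⁻¹ • (x - r • u) := by
    rw [smul_sub, smul_smul, inv_mul_cancel₀ hr.ne', one_smul]
  rw [dist_comm, dist_eq_norm, this, norm_smul, Real.norm_of_nonneg (by positivity)]
  calc r⁻¹ * ‖x - r • u‖ ≤ r⁻¹ * (ε / 2 * r) := by gcongr
    _ = ε / 2 := by field_simp
    _ < ε := by linarith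

lemma vtx_mem_closure {A : Set (Vec m i)} (hA : ∀ x ∈ A, ∀ s : ℝ, 0 < s → s • x ∈ A)
    {x : Vec m i} (hx : ∀ t : ℝ, 0 ≤ t → x + t • vtx ∈ A) : vtx ∈ closure A := by
  refine mem_closure_of_rays hA fun ε hε => ?_
  refine ⟨_, hx (‖x‖ / ε + 1) (by positivity), ‖x‖ / ε + 1, by positivity, ?_⟩
  have := norm_nonneg x
  rw [add_sub_cancel_right, mul_add, mul_div_cancel₀ _ hε.ne']
  linarith

/-- A properly convex set whose closure contains the vertex is bounded below in the direction of the
vertex. -/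
lemma exists_lower_bound {A : Set (Vec m i)} (hA : IsProperlyConvex A) (hv : vtx ∈ closure A) :
    ∃ C : ℝ, 0 < C ∧ ∀ κ s y t, ofBlocks κ s y t ∈ A → -C * (‖κ‖ + |s| + ‖y‖) ≤ t := by
  by_contra! hcon
  refine vtx_ne_zero (hA.no_antipodal _ hv (mem_closure_of_rays hA.smul_mem fun ε hε => ?_))
  obtain ⟨κ, s, y, t, hx, ht⟩ := hcon ε⁻¹ (by positivity)
  have hn : 0 ≤ ‖κ‖ + |s| + ‖y‖ := by positivity
  have ht0 : 0 < -t := by nlinarith [mul_nonneg (inv_nonneg.2 hε.le) hn]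
  refine ⟨_, hx, -t, ht0, ?_⟩
  have e : ofBlocks κ s y t - (-t) • -vtx = ofBlocks κ s y 0 := by
    refine vec_ext ?_ ?_ ?_ ?_ <;> simp
  rw [e]
  refine (norm_ofBlocks_le _ _ _ _).trans ?_
  have h2 : ε⁻¹ * (‖κ‖ + |s| + ‖y‖) ≤ -t := by linarith
  rw [abs_zero, add_zero]
  calc ‖κ‖ + |s| + ‖y‖ = ε * (ε⁻¹ * (‖κ‖ + |s| + ‖y‖)) := by field_simp
    _ ≤ _ := by gcongr

/-- The shear `T_C`, the identity in the first three blocks, adding `C` times the second block to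
the last one. It commutes with the end group and with the cusp group. -/
noncomputable def shear (C : ℝ) : Vec m i ≃L[ℝ] Vec m i :=
  LinearEquiv.toContinuousLinearEquiv
    { toFun := fun x => x + (C * x iO) • vtx
      invFun := fun x => x - (C * x iO) • vtx
      map_add' := fun x y => by
        simp only [Pi.add_apply, mul_add, add_smul]; abel
      map_smul' := fun r x => by
        simp only [Pi.smul_apply, smul_eq_mul, RingHom.id_apply, smul_add, smul_smul]
        congr 2; ring
      left_inv := fun x => by simp
      right_inv := fun x => by simp }

lemma shear_apply (C : ℝ) (x : Vec m i) : shear C x = x + (C * x iO) • vtx := rfl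

lemma shear_horo (C : ℝ) (κ : Fin m → ℝ) (y : Fin i → ℝ) (c : ℝ) :
    shear C (horo κ y c) = horo κ y (c + C) := by
  rw [shear_apply, ← horo_add_vtx]; simp [horo]

lemma shear_vtx (C : ℝ) : shear C (vtx : Vec m i) = vtx := by
  simp [shear_apply]

/-- The end group acts on the directions at the vertex, `Σ̃ = linkDomain Ω`, cocompactly, by
elements that normalize the cusp group. -/
structure IsCuspEnd (G : Subgroup (GL (Idx m i) ℝ)) (Ω : Set (Fin m → ℝ)) : Prop where
  base_pos : 0 < m
  fiber_pos : 0 < i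
  domain : IsProperlyConvexDomain Ω
  cocompact : CocompactOn G (vtxLine m i) (linkDomain Ω)
  normalizing : ∀ g ∈ G, IsCuspNormalizing g.val

variable {Otilde U V D : Set (Vec m i)} {Γ G : Subgroup (GL (Idx m i) ℝ)} {Ω : Set (Fin m → ℝ)}

lemma smul_mem_iff {E : Type*} [AddCommGroup E] [Module ℝ E] {A : Set E}
    (hA : ∀ x ∈ A, ∀ s : ℝ, 0 < s → s • x ∈ A) {x : E} {r : ℝ} (hr : 0 < r) :
    r • x ∈ A ↔ x ∈ A := by
  refine ⟨fun h => ?_, fun h => hA x h r hr⟩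
  have := hA _ h r⁻¹ (by positivity)
  rwa [smul_smul, inv_mul_cancel₀ hr.ne', one_smul] at this

lemma mulVec_mem_iff {g : GL (Idx m i) ℝ} (h : act g.val V = V) (x : Vec m i) :
    g.val *ᵥ x ∈ V ↔ x ∈ V := by
  constructor
  · intro hx
    rw [← h] at hx
    obtain ⟨y, hy, hxy⟩ := hx
    have : Function.Injective (fun x => g.val *ᵥ x) :=
      Matrix.mulVec_injective_of_isUnit g.isUnit
    rwa [← this hxy]
  · intro hx
    rw [← h]
    exact ⟨x, hx, rfl⟩

namespace IsCuspEnd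
variable (hC : IsCuspEnd G Ω)
include hC

lemma lamV_pos {g : GL (Idx m i) ℝ} (hg : g ∈ G) : 0 < lamV g.val :=
  (hC.normalizing g hg).lamV_pos hC.fiber_pos

lemma mulVec_horo {g : GL (Idx m i) ℝ} (hg : g ∈ G) (κ : Fin m → ℝ) (y : Fin i → ℝ) (c : ℝ) :
    g.val *ᵥ horo κ y c =
      lamV g.val • horo (coneMap g.val *ᵥ κ) (vecOf g.val + rot g.val *ᵥ y) (c + alpha7 g.val) :=
  (hC.normalizing g hg).mulVec_horo hC.fiber_pos κ y c

lemma horo_mem_iff_of_act {g : GL (Idx m i) ℝ} (hg : g ∈ G)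
    (hs : ∀ x ∈ V, ∀ s : ℝ, 0 < s → s • x ∈ V) (hV : act g.val V = V)
    (κ : Fin m → ℝ) (y : Fin i → ℝ) (c : ℝ) :
    horo (coneMap g.val *ᵥ κ) (vecOf g.val + rot g.val *ᵥ y) (c + alpha7 g.val) ∈ V ↔
      horo κ y c ∈ V := by
  rw [← mulVec_mem_iff hV (horo κ y c), hC.mulVec_horo hg, smul_mem_iff hs (hC.lamV_pos hg)]

/-- Over every `κ ∈ Ω` there are elements of `G` that bring a point of a compact set to `κ`, with a
translation along the leaf that is prescribed up to a bounded error. -/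
lemma exists_transitive : ∃ J ⊆ Ω, IsCompact J ∧ ∃ C : ℝ, ∀ κ ∈ Ω, ∀ y : Fin i → ℝ,
    ∃ g ∈ G, ∃ z ∈ J, coneMap g.val *ᵥ z = κ ∧ ‖vecOf g.val - y‖ ≤ C := by
  obtain ⟨J, hJ, hJc, hcov⟩ := hC.cocompact
  have hne : ∀ z ∈ J, z iO ≠ 0 := fun z hz => (hJ hz).2.ne'
  have hcO : ContinuousOn (fun z : Vec m i => z iO) J := by fun_prop
  have hcK : ContinuousOn (fun z : Vec m i => (z iO)⁻¹ • partK z) J := by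
    refine (hcO.inv₀ hne).smul (Continuous.continuousOn ?_)
    unfold partK; fun_prop
  have hcY : ContinuousOn (fun z : Vec m i =>
      ((fun j => z (iX j) / z iO : Fin i → ℝ) ⬝ᵥ (fun j => z (iX j) / z iO))) J := by
    unfold dotProduct
    refine continuousOn_finsetSum _ fun j _ => ?_
    refine ContinuousOn.mul (ContinuousOn.div (by fun_prop) hcO hne)
      (ContinuousOn.div (by fun_prop) hcO hne)
  obtain ⟨B, hB⟩ := (hJc.image_of_continuousOn hcY).bddAbove
  refine ⟨_, ?_, hJc.image_of_continuousOn hcK, Real.sqrt B, fun κ hκ y => ?_⟩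
  · rintro _ ⟨z, hz, rfl⟩
    exact hC.domain.2.smul_mem _ (hJ hz).1 _ (inv_pos.2 (hJ hz).2)
  obtain ⟨g, hg, z, hz, s, hs, t, ht⟩ := hcov (horo κ y 0) ⟨hκ, one_pos⟩
  have hzO := (hJ hz).2
  have hl := hC.lamV_pos hg
  rw [eq_smul_horo hzO, Matrix.mulVec_smul, hC.mulVec_horo hg, smul_smul, smul_smul,
    sub_eq_iff_eq_add'] at ht
  have h1 : s * z iO * lamV g.val = 1 := by
    have := congrFun ht iO
    simp [horo] at this
    linarith
  rw [h1, one_smul, horo_add_vtx] at ht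
  obtain ⟨h2, h3, -⟩ := horo_inj ht
  refine ⟨g, hg, _, ⟨z, hz, rfl⟩, h2.symm, ?_⟩
  rw [h3, sub_add_cancel_left, norm_neg]
  refine Real.le_sqrt_of_sq_le ((norm_sq_le_dotProduct _).trans ?_)
  rw [rot_dotProduct (hC.normalizing g hg).block]
  exact hB ⟨z, hz, rfl⟩

/-- A `G`-invariant cone over `Σ̃` in the ambient properly convex set is contained, up to a shear, in
any p-end neighborhood. In particular two p-end neighborhoods are nested up to shears. -/
lemma exists_shear_subset (hO : IsProperlyConvex Otilde) (hv : vtx ∈ closure Otilde)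
    (hU : IsPEndNbhd Otilde Γ G Ω U) (hVO : V ⊆ Otilde) (hVΩ : V ⊆ linkDomain Ω)
    (hVs : ∀ x ∈ V, ∀ s : ℝ, 0 < s → s • x ∈ V) (hVG : ∀ g ∈ G, act g.val V = V) :
    ∃ C : ℝ, ∀ x ∈ V, shear C x ∈ U := by
  obtain ⟨J, hJ, hJc, hcov⟩ := hC.cocompact
  obtain ⟨C₁, hC₁, hlow⟩ := exists_lower_bound hO hv
  -- a uniform radial height over the compact set `J` from which on the rays are in `U`
  have hup : ∃ B : ℝ, ∀ z ∈ J, ∀ t, B ≤ t → z + t • vtx ∈ U := by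
    refine hJc.induction_on (p := fun S => ∃ B : ℝ, ∀ z ∈ S, ∀ t, B ≤ t → z + t • vtx ∈ U)
      ⟨0, by simp⟩ (fun S T hST ⟨B, hB⟩ => ⟨B, fun z hz => hB z (hST hz)⟩)
      (fun S T ⟨B, hB⟩ ⟨B', hB'⟩ => ⟨max B B', fun z hz t ht => ?_⟩) fun z hz => ?_
    · rcases hz with hz | hz
      · exact hB z hz t ((le_max_left _ _).trans ht)
      · exact hB' z hz t ((le_max_right _ _).trans ht)
    · have : z ∈ directions U := hU.directions_eq ▸ hJ hz
      obtain ⟨t₀, ht₀⟩ := this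
      have ho : IsOpen {x : Vec m i | x + t₀ • vtx ∈ U} :=
        hU.isOpen.preimage (by fun_prop)
      refine ⟨_, mem_nhdsWithin_of_mem_nhds (ho.mem_nhds ht₀), t₀, fun x hx t ht => ?_⟩
      have := hU.radial _ hx (t - t₀) (by linarith)
      rwa [add_assoc, ← add_smul, add_sub_cancel] at this
  obtain ⟨B, hB⟩ := hup
  obtain ⟨R, hR⟩ := hJc.isBounded.exists_norm_le
  obtain ⟨ε, hε, hεJ⟩ : ∃ ε : ℝ, 0 < ε ∧ ∀ z ∈ J, ε ≤ z iO := by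
    rcases J.eq_empty_or_nonempty with rfl | hne
    · exact ⟨1, one_pos, by simp⟩
    · obtain ⟨z, hz, hmin⟩ := hJc.exists_isMinOn hne (f := fun z : Vec m i => z iO)
        (by fun_prop)
      exact ⟨z iO, (hJ hz).2, fun w hw => hmin hw⟩
  set C₂ : ℝ := B + C₁ * (R + R + R) + R
  refine ⟨|C₂| / ε, fun x hx => ?_⟩
  obtain ⟨g, hg, z, hz, s, hs, t, ht⟩ := hcov x (hVΩ hx)
  have hl := hC.lamV_pos hg
  have hR0 : 0 ≤ R := (norm_nonneg z).trans (hR z hz)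
  have hvt := (hC.normalizing g hg).mulVec_vtx
  set τ : ℝ := t / (s * lamV g.val)
  have hx1 : x = s • (g.val *ᵥ (z + τ • vtx)) := by
    rw [Matrix.mulVec_add, Matrix.mulVec_smul, hvt, smul_add, smul_smul, smul_smul,
      show s * τ * lamV g.val = t by simp only [τ]; field_simp, ← ht, add_sub_cancel]
  have hzV : z + τ • vtx ∈ V := by
    rw [hx1, smul_mem_iff hVs hs, mulVec_mem_iff (hVG g hg)] at hx
    exact hx
  have hcoord : ∀ a, |z a| ≤ R := fun a => (norm_le_pi_norm z a).trans (hR z hz)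
  have hτ : -(C₁ * (R + R + R) + R) ≤ τ := by
    have e : z + τ • vtx = ofBlocks (partK z) (z iO) (fun j => z (iX j)) (z iV + τ) := by
      refine vec_ext (fun _ => ?_) ?_ (fun _ => ?_) ?_ <;> simp
      rfl
    have h := hlow _ _ _ _ (e ▸ hVO hzV)
    have h1 : ‖partK z‖ ≤ R := (pi_norm_le_iff_of_nonneg hR0).2 fun a => hcoord (iK a)
    have h2 : ‖(fun j => z (iX j) : Fin i → ℝ)‖ ≤ R :=
      (pi_norm_le_iff_of_nonneg hR0).2 fun a => hcoord (iX a)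
    have h3 : C₁ * (‖partK z‖ + |z iO| + ‖(fun j => z (iX j) : Fin i → ℝ)‖) ≤
        C₁ * (R + R + R) := by
      gcongr
      exact hcoord iO
    have h4 := (abs_le.1 (hcoord iV)).2
    linarith
  have hsx : shear (|C₂| / ε) x =
      s • (g.val *ᵥ (z + (τ + |C₂| / ε * z iO) • vtx)) := by
    have hOx : x iO = s * (lamV g.val * z iO) := by
      have hgz : (g.val *ᵥ z) iO = lamV g.val * z iO := by
        rw [eq_smul_horo (hJ hz).2, Matrix.mulVec_smul, hC.mulVec_horo hg]
        simp [horo]; ring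
      rw [hx1, Matrix.mulVec_add, Matrix.mulVec_smul, hvt]
      simp [hgz]
    rw [shear_apply, hOx, hx1]
    simp only [Matrix.mulVec_add, Matrix.mulVec_smul, hvt, smul_add, smul_smul, add_smul]
    rw [add_assoc]
    congr 3
    ring
  rw [hsx, smul_mem_iff hU.smul_mem hs, mulVec_mem_iff (hU.invariant g hg)]
  refine hB z hz _ ?_
  have h5 : |C₂| ≤ |C₂| / ε * z iO := by
    calc |C₂| = |C₂| / ε * ε := by field_simp
      _ ≤ _ := by gcongr; exact hεJ z hz
  have := le_abs_self C₂
  simp only [C₂] at this h5 ⊢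
  linarith

/-- A linear map preserving `Ω` is bounded in norm by its value at an interior point, uniformly over
a compact set of interior points. -/
lemma exists_norm_mulVec_le {J : Set (Fin m → ℝ)} (hJ : J ⊆ Ω) (hJc : IsCompact J) :
    ∃ C : ℝ, 0 < C ∧ ∀ A : Matrix (Fin m) (Fin m) ℝ, (∀ κ ∈ Ω, A *ᵥ κ ∈ Ω) →
      ∀ z ∈ J, ∀ w, ‖A *ᵥ w‖ ≤ C * ‖A *ᵥ z‖ * ‖w‖ := by
  obtain ⟨hΩo, hΩ⟩ := hC.domain
  -- since the closure of `Ω` contains no line, a sum in `Ω` dominates its summands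
  have hdom : ∃ c : ℝ, 0 < c ∧ ∀ a ∈ Ω, ∀ b ∈ Ω, ‖a‖ ≤ c * ‖a + b‖ := by
    by_contra! hcon
    have hn : ∀ n : ℕ, ∃ a ∈ closure Ω, ∃ b ∈ Ω, ‖a‖ = 1 ∧ ‖a + b‖ < 1 / ((n : ℝ) + 1) := by
      intro n
      obtain ⟨a, ha, b, hb, hab⟩ := hcon (n + 1) (by positivity)
      have ha0 : 0 < ‖a‖ := norm_pos_iff.2 fun h => hΩ.zero_notMem (h ▸ ha)
      refine ⟨‖a‖⁻¹ • a, subset_closure (hΩ.smul_mem a ha _ (by positivity)), ‖a‖⁻¹ • b,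
        hΩ.smul_mem b hb _ (by positivity), ?_, ?_⟩
      · rw [norm_smul, norm_inv, norm_norm, inv_mul_cancel₀ ha0.ne']
      · rw [← smul_add, norm_smul, norm_inv, norm_norm, lt_div_iff₀ (by positivity)]
        rw [inv_mul_eq_div, div_mul_eq_mul_div, div_lt_one ha0]
        linarith
    choose a ha b hb ha1 hab using hn
    obtain ⟨a₀, -, φ, hφ, hlim⟩ := (isCompact_sphere (0 : Fin m → ℝ) 1).tendsto_subseq
      (x := a) fun n => by simp [ha1 n]
    have hlim0 : Tendsto (fun n => a n + b n) atTop (nhds 0) :=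
      squeeze_zero_norm (fun n => (hab n).le) tendsto_one_div_add_atTop_nhds_zero_nat
    have h1 : a₀ ∈ closure Ω := isClosed_closure.mem_of_tendsto hlim
      (Eventually.of_forall fun n => ha _)
    have hlimb : Tendsto (fun n => b (φ n)) atTop (nhds (-a₀)) := by
      have := (hlim0.comp hφ.tendsto_atTop).sub hlim
      simpa [Function.comp_def] using this
    have h2 : -a₀ ∈ closure Ω := isClosed_closure.mem_of_tendsto hlimb
      (Eventually.of_forall fun n => subset_closure (hb _))
    have h3 := hΩ.no_antipodal _ h1 h2
    have h4 : Tendsto (fun n => ‖a (φ n)‖) atTop (nhds ‖a₀‖) := hlim.norm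
    simp only [ha1] at h4
    have := tendsto_nhds_unique h4 tendsto_const_nhds
    simp [h3] at this
  obtain ⟨c, hc, hdom⟩ := hdom
  obtain ⟨ε, hε, hth⟩ := hJc.exists_cthickening_subset_open hΩo hJ
  refine ⟨2 * c / ε, by positivity, fun A hA z hz w => ?_⟩
  rcases eq_or_ne w 0 with rfl | hw
  · simp
  have hw0 : 0 < ‖w‖ := norm_pos_iff.2 hw
  set u := (ε / ‖w‖) • w
  have hu : ‖u‖ = ε := by
    simp only [u]
    rw [norm_smul, Real.norm_of_nonneg (by positivity), div_mul_cancel₀ _ hw0.ne']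
  have hm : ∀ v : Fin m → ℝ, ‖v‖ = ε → A *ᵥ (z + v) ∈ Ω := fun v hv =>
    hA _ (hth (Metric.mem_cthickening_of_dist_le _ z _ _ hz (by simp [dist_eq_norm, hv])))
  have h1 := hm u hu
  have h2 := hm (-u) (by rw [norm_neg, hu])
  have h3 := hdom _ h1 _ h2
  have h4 := hdom _ h2 _ h1
  have e1 : A *ᵥ (z + u) + A *ᵥ (z + -u) = (2 : ℝ) • (A *ᵥ z) := by
    rw [Matrix.mulVec_add, Matrix.mulVec_add, Matrix.mulVec_neg, two_smul]; abel
  have e2 : A *ᵥ (z + u) - A *ᵥ (z + -u) = (2 * (ε / ‖w‖)) • (A *ᵥ w) := by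
    simp only [u]
    rw [Matrix.mulVec_add, Matrix.mulVec_add, Matrix.mulVec_neg, Matrix.mulVec_smul]
    module
  rw [add_comm (A *ᵥ (z + -u)) (A *ᵥ (z + u))] at h4
  rw [e1, norm_smul] at h3 h4
  have h5 := norm_sub_le (A *ᵥ (z + u)) (A *ᵥ (z + -u))
  rw [e2, norm_smul, Real.norm_of_nonneg (by positivity)] at h5
  norm_num at h3 h4
  have h6 : ε / ‖w‖ * ‖A *ᵥ w‖ ≤ 2 * c * ‖A *ᵥ z‖ := by linarith
  calc ‖A *ᵥ w‖ = (‖w‖ / ε) * (ε / ‖w‖ * ‖A *ᵥ w‖) := by field_simp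
    _ ≤ (‖w‖ / ε) * (2 * c * ‖A *ᵥ z‖) := by gcongr
    _ = _ := by ring

end IsCuspEnd

/-! ### The height function -/

/-- The horospherical height of the boundary of a cusp-invariant p-end neighborhood over a point
of `Ω`, where the infimum is over a nonempty set that is bounded below. -/
noncomputable def height (U : Set (Vec m i)) (κ : Fin m → ℝ) : ℝ := sInf {c | horo κ 0 c ∈ U}

/-- A p-end neighborhood in a properly convex set, invariant under the cusp group. -/
structure IsCuspNbhd (Otilde : Set (Vec m i)) (Γ G : Subgroup (GL (Idx m i) ℝ))
    (Ω : Set (Fin m → ℝ)) (U : Set (Vec m i)) : Prop where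
  nbhd : IsPEndNbhd Otilde Γ G Ω U
  ambient : IsProperlyConvex Otilde
  cusp_act : ∀ v : Fin i → ℝ, act (cusp v) U = U

lemma IsPEndNbhd.subset_linkDomain (hU : IsPEndNbhd Otilde Γ G Ω U) : U ⊆ linkDomain Ω := by
  intro x hx
  rw [← hU.directions_eq]
  exact ⟨0, by simpa using hx⟩

lemma IsPEndNbhd.vtx_mem_closure (hU : IsPEndNbhd Otilde Γ G Ω U) : vtx ∈ closure U := by
  obtain ⟨x, hx⟩ := hU.connected.nonempty
  exact QJoin.vtx_mem_closure hU.smul_mem (hU.radial x hx)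

namespace IsCuspNbhd
variable (hU : IsCuspNbhd Otilde Γ G Ω U)
include hU

lemma horo_mem_iff_horo_zero (κ : Fin m → ℝ) (y : Fin i → ℝ) (c : ℝ) :
    horo κ y c ∈ U ↔ horo κ 0 c ∈ U := by
  have h : ∀ y w, horo κ y c ∈ U → horo κ (y + w) c ∈ U := fun y w hy => by
    rw [← hU.cusp_act w, ← cusp_mulVec_horo]
    exact ⟨_, hy, rfl⟩
  exact ⟨fun h1 => by simpa using h y (-y) h1, fun h1 => by simpa using h 0 y h1⟩

lemma exists_height_lower_bound :
    ∃ C : ℝ, 0 < C ∧ ∀ κ c, horo κ 0 c ∈ U → -C * (‖κ‖ + 1) ≤ c := by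
  obtain ⟨C, hC, h⟩ := exists_lower_bound hU.ambient
    (closure_mono hU.nbhd.subset hU.nbhd.vtx_mem_closure)
  refine ⟨C, hC, fun κ c hc => ?_⟩
  simpa using h _ _ _ _ (hU.nbhd.subset hc)

/-- `U` is the region above the graph of its height. -/
lemma horo_mem_iff (κ : Fin m → ℝ) (y : Fin i → ℝ) (c : ℝ) :
    horo κ y c ∈ U ↔ κ ∈ Ω ∧ height U κ < c := by
  rw [hU.horo_mem_iff_horo_zero]
  have hrad : ∀ c c', horo κ 0 c ∈ U → c ≤ c' → horo κ 0 c' ∈ U := fun c c' h hcc => by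
    have := hU.nbhd.radial _ h (c' - c) (by linarith)
    rwa [horo_add_vtx, add_sub_cancel] at this
  constructor
  · intro h
    obtain ⟨C, -, hlow⟩ := hU.exists_height_lower_bound
    refine ⟨(hU.nbhd.subset_linkDomain h).1, ?_⟩
    have ho : IsOpen {r : ℝ | horo κ 0 c + r • vtx ∈ U} :=
      hU.nbhd.isOpen.preimage (by fun_prop)
    obtain ⟨ε, hε, hb⟩ := Metric.isOpen_iff.1 ho 0 (by simpa using h)
    have h2 : -(ε / 2) ∈ Metric.ball (0 : ℝ) ε := by
      rw [Metric.mem_ball, dist_zero_right, norm_neg, Real.norm_of_nonneg (by positivity)]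
      linarith
    have h3 := hb h2
    rw [Set.mem_ofPred_eq, horo_add_vtx] at h3
    have : height U κ ≤ c + -(ε / 2) := csInf_le ⟨_, fun r hr => hlow κ r hr⟩ h3
    linarith
  · rintro ⟨hκ, hc⟩
    have hne : {c | horo κ 0 c ∈ U}.Nonempty := by
      have : (horo κ 0 0 : Vec m i) ∈ directions U := by
        rw [hU.nbhd.directions_eq]; exact ⟨hκ, one_pos⟩
      obtain ⟨t, ht⟩ := this
      rw [horo_add_vtx] at ht
      exact ⟨_, ht⟩
    obtain ⟨c', hc', hlt⟩ := exists_lt_of_csInf_lt hne hc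
    exact hrad _ _ hc' hlt.le

lemma mem_iff (x : Vec m i) : x ∈ U ↔
    0 < x iO ∧ (x iO)⁻¹ • partK x ∈ Ω ∧ height U ((x iO)⁻¹ • partK x) < horoHeight x := by
  constructor
  · intro hx
    have h := (hU.nbhd.subset_linkDomain hx).2
    refine ⟨h, ?_⟩
    rwa [eq_smul_horo h, smul_mem_iff hU.nbhd.smul_mem h, hU.horo_mem_iff] at hx
  · rintro ⟨h, h2⟩
    rwa [eq_smul_horo h, smul_mem_iff hU.nbhd.smul_mem h, hU.horo_mem_iff]

lemma exists_le_height : ∃ C : ℝ, 0 < C ∧ ∀ κ ∈ Ω, -C * (‖κ‖ + 1) ≤ height U κ := by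
  obtain ⟨C, hC, h⟩ := hU.exists_height_lower_bound
  refine ⟨C, hC, fun κ hκ => le_of_forall_gt_imp_ge_of_dense fun c hc => ?_⟩
  exact h κ c ((hU.horo_mem_iff κ 0 c).2 ⟨hκ, hc⟩)

lemma upperSemicontinuousOn_height : UpperSemicontinuousOn (height U) Ω := by
  intro κ hκ c hc
  have ho : IsOpen {κ' : Fin m → ℝ | horo κ' 0 c ∈ U} := by
    refine hU.nbhd.isOpen.preimage ?_
    refine continuous_pi fun a => ?_
    rcases a with a | a | a | a
    · change Continuous fun κ' : Fin m → ℝ => κ' a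
      fun_prop
    all_goals exact continuous_const
  refine mem_of_superset (mem_nhdsWithin_of_mem_nhds (ho.mem_nhds
    ((hU.horo_mem_iff κ 0 c).2 ⟨hκ, hc⟩))) fun κ' h' => ((hU.horo_mem_iff κ' 0 c).1 h').2

variable (hC : IsCuspEnd G Ω)
include hC

lemma coneMap_mem {g : GL (Idx m i) ℝ} (hg : g ∈ G) {κ : Fin m → ℝ} (hκ : κ ∈ Ω) :
    coneMap g.val *ᵥ κ ∈ Ω := by
  have h := (hU.horo_mem_iff κ 0 (height U κ + 1)).2 ⟨hκ, by linarith⟩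
  rw [← hC.horo_mem_iff_of_act hg hU.nbhd.smul_mem (hU.nbhd.invariant g hg), hU.horo_mem_iff] at h
  exact h.1

/-- The height is equivariant: this makes `alpha7` a homomorphism on the end group. -/
lemma height_coneMap {g : GL (Idx m i) ℝ} (hg : g ∈ G) {κ : Fin m → ℝ} (hκ : κ ∈ Ω) :
    height U (coneMap g.val *ᵥ κ) = height U κ + alpha7 g.val := by
  have h : ∀ c, height U (coneMap g.val *ᵥ κ) < c + alpha7 g.val ↔ height U κ < c := fun c => by
    have h := hC.horo_mem_iff_of_act hg hU.nbhd.smul_mem (hU.nbhd.invariant g hg) κ 0 c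
    simpa [hU.horo_mem_iff, hκ, hU.coneMap_mem hC hg hκ] using h
  refine eq_of_forall_gt_iff fun c => ?_
  have := h (c - alpha7 g.val)
  rw [sub_add_cancel] at this
  rw [this, lt_sub_iff_add_lt]

lemma coneMap_pow_mem {g : GL (Idx m i) ℝ} (hg : g ∈ G) {κ : Fin m → ℝ} (hκ : κ ∈ Ω) (n : ℕ) :
    coneMap g.val ^ n *ᵥ κ ∈ Ω := by
  induction n with
  | zero => simpa using hκ
  | succ n ih => rw [pow_succ', ← Matrix.mulVec_mulVec]; exact hU.coneMap_mem hC hg ih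

lemma height_coneMap_pow {g : GL (Idx m i) ℝ} (hg : g ∈ G) {κ : Fin m → ℝ} (hκ : κ ∈ Ω) (n : ℕ) :
    height U (coneMap g.val ^ n *ᵥ κ) = height U κ + n * alpha7 g.val := by
  induction n with
  | zero => simp
  | succ n ih =>
    rw [pow_succ', ← Matrix.mulVec_mulVec,
      hU.height_coneMap hC hg (hU.coneMap_pow_mem hC hg hκ n), ih]
    push_cast; ring

end IsCuspNbhd

/-! ### Eigenvalues -/

section Eigenvalues
variable {ι : Type*} [Fintype ι]

lemma re_mulVec (A : Matrix ι ι ℝ) (x : ι → ℂ) :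
    (fun a => ((A.map (algebraMap ℝ ℂ) *ᵥ x) a).re) = A *ᵥ fun a => (x a).re := by
  funext a; simp [Matrix.mulVec, dotProduct]

lemma im_mulVec (A : Matrix ι ι ℝ) (x : ι → ℂ) :
    (fun a => ((A.map (algebraMap ℝ ℂ) *ᵥ x) a).im) = A *ᵥ fun a => (x a).im := by
  funext a; simp [Matrix.mulVec, dotProduct]

variable [DecidableEq ι]

lemma mem_eigNorms {A : Matrix ι ι ℝ} {r : ℝ} : r ∈ eigNorms A ↔
    ∃ (z : ℂ) (x : ι → ℂ), x ≠ 0 ∧ A.map (algebraMap ℝ ℂ) *ᵥ x = z • x ∧ r = ‖z‖ := by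
  unfold eigNorms
  simp only [← Matrix.spectrum_toLin', ← Module.End.hasEigenvalue_iff_mem_spectrum,
    Set.mem_ofPred_eq]
  constructor
  · rintro ⟨z, hz, rfl⟩
    obtain ⟨x, hx⟩ := hz.exists_hasEigenvector
    exact ⟨z, x, hx.2, by simpa using hx.apply_eq_smul, rfl⟩
  · rintro ⟨z, x, hx, hzx, rfl⟩
    exact ⟨z, Module.End.hasEigenvalue_of_hasEigenvector
      (Module.End.hasEigenvector_iff.2 ⟨Module.End.mem_eigenspace_iff.2 (by simpa using hzx), hx⟩),
      rfl⟩

lemma eigNorms_finite (A : Matrix ι ι ℝ) : (eigNorms A).Finite := by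
  have h : (spectrum ℂ (A.map (algebraMap ℝ ℂ))).Finite := Matrix.finite_spectrum _
  refine (h.image (fun z => ‖z‖)).subset ?_
  rintro r ⟨z, hz, rfl⟩
  exact ⟨z, hz, rfl⟩

lemma eigNorms_nonempty [Nonempty ι] (A : Matrix ι ι ℝ) : (eigNorms A).Nonempty := by
  obtain ⟨z, hz⟩ := spectrum.nonempty_of_isAlgClosed_of_finiteDimensional ℂ
    (A.map (algebraMap ℝ ℂ))
  exact ⟨_, z, hz, rfl⟩

lemma maxEigNorm_mem [Nonempty ι] (A : Matrix ι ι ℝ) : maxEigNorm A ∈ eigNorms A :=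
  (eigNorms_nonempty A).csSup_mem (eigNorms_finite A)

lemma le_maxEigNorm {A : Matrix ι ι ℝ} {r : ℝ} (hr : r ∈ eigNorms A) : r ≤ maxEigNorm A :=
  le_csSup (eigNorms_finite A).bddAbove hr

/-- The factor `2` accounts for passing to the real and imaginary parts of an eigenvector. -/
lemma eigNorm_le_of_norm_mulVec_le {A : Matrix ι ι ℝ} {C : ℝ} (h : ∀ x, ‖A *ᵥ x‖ ≤ C * ‖x‖)
    {r : ℝ} (hr : r ∈ eigNorms A) : r ≤ 2 * C := by
  obtain ⟨z, x, hx, hzx, rfl⟩ := mem_eigNorms.1 hr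
  have hx0 : 0 < ‖x‖ := norm_pos_iff.2 hx
  have hre : ‖fun a => (x a).re‖ ≤ ‖x‖ := (pi_norm_le_iff_of_nonneg hx0.le).2 fun a =>
    (Complex.abs_re_le_norm _).trans (norm_le_pi_norm x a)
  have him : ‖fun a => (x a).im‖ ≤ ‖x‖ := (pi_norm_le_iff_of_nonneg hx0.le).2 fun a =>
    (Complex.abs_im_le_norm _).trans (norm_le_pi_norm x a)
  have hC : 0 ≤ C := by
    by_contra! hC
    have h1 : ∀ y : ι → ℝ, y = 0 := fun y => by
      by_contra hy
      have := norm_pos_iff.2 hy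
      nlinarith [h y, norm_nonneg (A *ᵥ y)]
    refine hx (funext fun a => Complex.ext ?_ ?_)
    exacts [congrFun (h1 fun a => (x a).re) a, congrFun (h1 fun a => (x a).im) a]
  have h2 : ‖z • x‖ ≤ 2 * C * ‖x‖ := by
    rw [← hzx, pi_norm_le_iff_of_nonneg (by positivity)]
    intro a
    refine (Complex.norm_le_abs_re_add_abs_im _).trans ?_
    have h3 := (norm_le_pi_norm (A *ᵥ fun a => (x a).re) a).trans (h _)
    have h4 := (norm_le_pi_norm (A *ᵥ fun a => (x a).im) a).trans (h _)
    rw [← re_mulVec] at h3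
    rw [← im_mulVec] at h4
    simp only [Real.norm_eq_abs] at h3 h4
    nlinarith
  rw [norm_smul] at h2
  exact le_of_mul_le_mul_right h2 hx0

lemma eigNorm_pos {A : Matrix ι ι ℝ} (hA : ∀ x, A *ᵥ x = 0 → x = 0) {r : ℝ}
    (hr : r ∈ eigNorms A) : 0 < r := by
  obtain ⟨z, x, hx, hzx, rfl⟩ := mem_eigNorms.1 hr
  refine norm_pos_iff.2 fun hz => hx ?_
  rw [hz, zero_smul] at hzx
  have h1 := hA _ ((re_mulVec A x).symm.trans (by rw [hzx]; rfl))
  have h2 := hA _ ((im_mulVec A x).symm.trans (by rw [hzx]; rfl))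
  exact funext fun a => Complex.ext (congrFun h1 a) (congrFun h2 a)

open scoped Matrix.Norms.Operator in
/-- Gelfand's formula: the powers of a matrix grow at most at the rate of its eigenvalues. -/
lemma eventually_norm_pow_mulVec_le {A : Matrix ι ι ℝ} {r : ℝ} (hr : 0 < r)
    (hAr : maxEigNorm A < r) :
    ∀ᶠ n : ℕ in atTop, ∀ x : ι → ℝ, ‖A ^ n *ᵥ x‖ ≤ r ^ n * ‖x‖ := by
  set B : Matrix ι ι ℂ := A.map (algebraMap ℝ ℂ)
  have : CompleteSpace (Matrix ι ι ℂ) := FiniteDimensional.complete ℂ _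
  have hrad : spectralRadius ℂ B < ENNReal.ofReal r := by
    refine lt_of_le_of_lt (b := ENNReal.ofReal (maxEigNorm A)) ?_
      ((ENNReal.ofReal_lt_ofReal_iff hr).2 hAr)
    refine iSup₂_le fun z hz => ?_
    have : ‖z‖ ≤ maxEigNorm A := le_maxEigNorm ⟨z, hz, rfl⟩
    refine le_trans (b := ‖z‖ₑ) le_rfl ?_
    rw [← ofReal_norm]
    exact ENNReal.ofReal_le_ofReal this
  have hev := (spectrum.pow_norm_pow_one_div_tendsto_nhds_spectralRadius B).eventually
    (gt_mem_nhds hrad)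
  filter_upwards [hev, eventually_gt_atTop 0] with n hn hn0 x
  have h1 : ‖B ^ n‖ ≤ r ^ n := by
    have h2 := ((ENNReal.ofReal_lt_ofReal_iff hr).1 hn).le
    have h3 := pow_le_pow_left₀ (by positivity) h2 n
    rwa [one_div, Real.rpow_inv_natCast_pow (norm_nonneg _) hn0.ne'] at h3
  have hBn : B ^ n = (A ^ n).map (algebraMap ℝ ℂ) := (Matrix.map_pow A (algebraMap ℝ ℂ) n).symm
  have h4 := Matrix.linfty_opNorm_mulVec (B ^ n) (fun a => (x a : ℂ))
  have h5 : ∀ y : ι → ℝ, ‖(fun a => (y a : ℂ))‖ = ‖y‖ := fun y => by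
    simp [Pi.norm_def, Complex.nnnorm_real]
  have h6 : B ^ n *ᵥ (fun a => (x a : ℂ)) = fun a => ((A ^ n *ᵥ x) a : ℂ) := by
    rw [hBn]; funext a; simp [Matrix.mulVec, dotProduct]
  rw [h6, h5, h5] at h4
  exact h4.trans (by gcongr)

end Eigenvalues

namespace IsCuspNormalizing
variable {g : Matrix (Idx m i) (Idx m i) ℝ} (hg : IsCuspNormalizing g)
include hg

/-- The complex eigenvalues of the block `a_5 O_5` all have norm `a_5`. -/
lemma norm_eq_of_mulVec_A5 (hi : 0 < i) {z : ℂ} {y : Fin i → ℂ} (hy : y ≠ 0)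
    (h : (A5 g).map (algebraMap ℝ ℂ) *ᵥ y = z • y) : ‖z‖ = lamV g := by
  set p : Fin i → ℝ := fun a => (y a).re
  set q : Fin i → ℝ := fun a => (y a).im
  have hl := hg.lamV_pos hi
  have hre : lamV g • (rot g *ᵥ p) = fun a => z.re * p a - z.im * q a := by
    have := re_mulVec (A5 g) y
    rw [h, hg.A5_eq, ← hg.lamV_eq hi, Matrix.smul_mulVec] at this
    rw [← this]; funext a; simp [p, q]
  have him : lamV g • (rot g *ᵥ q) = fun a => z.re * q a + z.im * p a := by
    have := im_mulVec (A5 g) y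
    rw [h, hg.A5_eq, ← hg.lamV_eq hi, Matrix.smul_mulVec] at this
    rw [← this]; funext a; simp [p, q]
  have h1 := congrArg₂ (· + ·) (congrArg₂ (· ⬝ᵥ ·) hre hre) (congrArg₂ (· ⬝ᵥ ·) him him)
  simp only [smul_dotProduct, dotProduct_smul, rot_dotProduct hg.block] at h1
  have h2 : (fun a => z.re * p a - z.im * q a) ⬝ᵥ (fun a => z.re * p a - z.im * q a) +
      (fun a => z.re * q a + z.im * p a) ⬝ᵥ (fun a => z.re * q a + z.im * p a) =
      ‖z‖ ^ 2 * (p ⬝ᵥ p + q ⬝ᵥ q) := by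
    rw [Complex.sq_norm, Complex.normSq_apply]
    simp only [dotProduct, Finset.mul_sum, ← Finset.sum_add_distrib]
    refine Finset.sum_congr rfl fun a _ => ?_
    ring
  rw [h2] at h1
  have h3 : 0 < p ⬝ᵥ p + q ⬝ᵥ q := by
    have hp0 : 0 ≤ p ⬝ᵥ p := Finset.sum_nonneg fun j _ => mul_self_nonneg _
    have hq0 : 0 ≤ q ⬝ᵥ q := Finset.sum_nonneg fun j _ => mul_self_nonneg _
    by_contra! hcon
    have hp1 : p = 0 := dotProduct_self_eq_zero.1 (by linarith)
    have hq1 : q = 0 := dotProduct_self_eq_zero.1 (by linarith)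
    exact hy (funext fun a => Complex.ext (congrFun hp1 a) (congrFun hq1 a))
  have h4 : ‖z‖ ^ 2 = lamV g ^ 2 := by
    simp only [smul_eq_mul] at h1
    nlinarith
  exact (pow_left_inj₀ (norm_nonneg _) hl.le two_ne_zero).1 h4

/-- Outside the block `S`, all eigenvalues have norm `λ_v`. -/
lemma eigNorms_eq (hi : 0 < i) : eigNorms g = insert (lamV g) (eigNorms (bS g)) := by
  have hb := hg.block
  have hl := hg.lamV_pos hi
  have e : ∀ (x : Idx m i → ℂ) (a : Idx m i), (g.map (algebraMap ℝ ℂ) *ᵥ x) a =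
      (∑ b, (g a (iK b) : ℂ) * x (iK b)) + ((g a iO : ℂ) * x iO +
      ((∑ j, (g a (iX j) : ℂ) * x (iX j)) + (g a iV : ℂ) * x iV)) := fun x a => by
    simp [Matrix.mulVec, dotProduct, Fintype.sum_sum_type, iK, iO, iX, iV]
  ext r
  constructor
  · intro hr
    obtain ⟨z, x, hx, hzx, rfl⟩ := mem_eigNorms.1 hr
    have ez : ∀ a, (∑ b, (g a (iK b) : ℂ) * x (iK b)) + ((g a iO : ℂ) * x iO +
      ((∑ j, (g a (iX j) : ℂ) * x (iX j)) + (g a iV : ℂ) * x iV)) = z * x a := fun a => by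
      rw [← e, hzx]; rfl
    -- descend through the blocks to the first one on which the eigenvector does not vanish
    by_cases hK : (fun a => x (iK a)) = 0
    · left
      have hK' : ∀ a, x (iK a) = 0 := fun a => congrFun hK a
      by_cases hO : x iO = 0
      · by_cases hX : (fun j => x (iX j)) = 0
        · have hX' : ∀ a, x (iX a) = 0 := fun a => congrFun hX a
          have hV : x iV ≠ 0 := fun hV => hx (by
            funext a
            rcases a with a | a | a | a
            exacts [hK' a, hO, hX' a, hV])
          have h1 := ez iV
          simp only [hK', hO, hX', mul_zero, Finset.sum_const_zero, zero_add] at h1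
          rw [← mul_right_cancel₀ hV h1, Complex.norm_real]
          exact Real.norm_of_nonneg hl.le
        · refine hg.norm_eq_of_mulVec_A5 hi hX (funext fun j => ?_)
          have h1 := ez (iX j)
          simp only [hK', hO, mul_zero, Finset.sum_const_zero, zero_add, hb.X_V,
            Complex.ofReal_zero, zero_mul, add_zero] at h1
          simpa [Matrix.mulVec, dotProduct, A5] using h1
      · have h1 := ez iO
        simp only [hK', mul_zero, Finset.sum_const_zero, zero_add, hb.O_X, hb.O_V,
          Complex.ofReal_zero, zero_mul, add_zero] at h1
        rw [← mul_right_cancel₀ hO h1, Complex.norm_real, hg.lamV_eq hi]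
        exact Real.norm_of_nonneg hg.a1_pos.le
    · right
      refine mem_eigNorms.2 ⟨z, fun a => x (iK a), hK, funext fun a => ?_, rfl⟩
      have h1 := ez (iK a)
      simp only [hb.K_O, hb.K_X, hb.K_V, Complex.ofReal_zero, zero_mul, add_zero,
        Finset.sum_const_zero] at h1
      simpa [Matrix.mulVec, dotProduct, bS] using h1
  · rintro (rfl | hr)
    · refine mem_eigNorms.2 ⟨(lamV g : ℂ), Pi.single iV 1, by simp, ?_, ?_⟩
      · funext a
        rw [e]
        rcases a with a | a | a | a
        · simp [iV, iO, iK, iX, show g (Sum.inl a) (Sum.inr (Sum.inr (Sum.inr ()))) = 0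
            from hb.K_V a]
        · simp [iV, iO, iK, iX, show g (Sum.inr (Sum.inl ())) (Sum.inr (Sum.inr (Sum.inr ()))) = 0
            from hb.O_V]
        · simp [iV, iO, iK, iX, show g (Sum.inr (Sum.inr (Sum.inl a)))
            (Sum.inr (Sum.inr (Sum.inr ()))) = 0 from hb.X_V a]
        · simp [iV, iO, iK, iX, lamV]
      · rw [Complex.norm_real, Real.norm_of_nonneg hl.le]
    · obtain ⟨z, x, hx, hzx, rfl⟩ := mem_eigNorms.1 hr
      refine mem_eigNorms.2 ⟨z, Sum.elim x 0, fun h => hx (funext fun a =>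
        congrFun h (Sum.inl a)), funext fun a => ?_, rfl⟩
      rw [e]
      rcases a with a | a | a | a
      · have := congrFun hzx a
        simpa [Matrix.mulVec, dotProduct, iV, iO, iK, iX, bS] using this
      · have h0 : ∀ b, g (Sum.inr (Sum.inl ())) (Sum.inl b) = 0 := hb.O_K
        simp [iV, iO, iK, iX, h0]
      · have h0 : ∀ b, g (Sum.inr (Sum.inr (Sum.inl a))) (Sum.inl b) = 0 := hb.X_K a
        simp [iV, iO, iK, iX, h0]
      · have h0 : ∀ b, g (Sum.inr (Sum.inr (Sum.inr ()))) (Sum.inl b) = 0 := hb.V_K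
        simp [iV, iO, iK, iX, h0]

lemma maxEigNorm_eq (hi : 0 < i) (h : lamK g < lamV g) : maxEigNorm g = lamV g := by
  rw [maxEigNorm, hg.eigNorms_eq hi]
  refine IsGreatest.csSup_eq ⟨Set.mem_insert _ _, ?_⟩
  rintro r (rfl | hr)
  exacts [le_rfl, (le_maxEigNorm hr).trans h.le]

lemma secondEigNorm_eq (hm : 0 < m) (hi : 0 < i) (h : lamK g < lamV g) :
    secondEigNorm g = lamK g := by
  have : Nonempty (Fin m) := ⟨⟨0, hm⟩⟩
  rw [secondEigNorm, hg.maxEigNorm_eq hi h, hg.eigNorms_eq hi]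
  refine IsGreatest.csSup_eq ⟨⟨Or.inr (maxEigNorm_mem _), h⟩, ?_⟩
  rintro r ⟨rfl | hr, hlt⟩
  exacts [absurd hlt (lt_irrefl _), le_maxEigNorm hr]

end IsCuspNormalizing

namespace IsCuspEnd
variable (hC : IsCuspEnd G Ω)
include hC

lemma lamK_pos {g : GL (Idx m i) ℝ} (hg : g ∈ G) : 0 < lamK g.val := by
  have : Nonempty (Fin m) := ⟨⟨0, hC.base_pos⟩⟩
  refine eigNorm_pos (fun x hx => ?_) (maxEigNorm_mem (bS g.val))
  have h1 : g.val *ᵥ (ofBlocks x 0 0 0) = g.val *ᵥ 0 := by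
    rw [mulVec_ofBlocks (hC.normalizing g hg).block, hx, Matrix.mulVec_zero]
    refine vec_ext ?_ ?_ ?_ ?_ <;> simp
  have h2 := Matrix.mulVec_injective_of_isUnit g.isUnit h1
  exact congrArg partK h2

lemma mem_Gplus_iff {g : GL (Idx m i) ℝ} : g ∈ Gplus G ↔ g ∈ G ∧ lamK g.val < lamV g.val :=
  ⟨fun h => ⟨h.1, h.2.2⟩, fun h =>
    ⟨h.1, (hC.normalizing g h.1).maxEigNorm_eq hC.fiber_pos h.2, h.2⟩⟩

lemma mu7_eq {g : GL (Idx m i) ℝ} (hg : g ∈ Gplus G) :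
    mu7 g.val = alpha7 g.val / Real.log (lamV g.val / lamK g.val) := by
  rw [mu7, (hC.normalizing g hg.1).secondEigNorm_eq hC.base_pos hC.fiber_pos hg.2.2]

lemma log_pos {g : GL (Idx m i) ℝ} (hg : g ∈ Gplus G) :
    0 < Real.log (lamV g.val / lamK g.val) :=
  Real.log_pos ((one_lt_div (hC.lamK_pos hg.1)).2 hg.2.2)

lemma lamK_le {g : GL (Idx m i) ℝ} (hg : g ∈ G) {C : ℝ}
    (h : ∀ w, ‖coneMap g.val *ᵥ w‖ ≤ C * ‖w‖) : lamK g.val ≤ 2 * C * lamV g.val := by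
  have : Nonempty (Fin m) := ⟨⟨0, hC.base_pos⟩⟩
  have hl := hC.lamV_pos hg
  have h1 : ∀ w, ‖bS g.val *ᵥ w‖ ≤ (lamV g.val * C) * ‖w‖ := fun w => by
    have h2 := h w
    rw [coneMap, Matrix.smul_mulVec, norm_smul, norm_inv, Real.norm_of_nonneg hl.le,
      inv_mul_le_iff₀ hl] at h2
    linarith
  have := eigNorm_le_of_norm_mulVec_le h1 (maxEigNorm_mem _)
  rw [lamK]
  linarith

lemma eventually_norm_coneMap_pow_le {g : GL (Idx m i) ℝ} (hg : g ∈ G) {r : ℝ} (hr : 0 < r)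
    (h : lamK g.val < r * lamV g.val) :
    ∀ᶠ n : ℕ in atTop, ∀ x, ‖coneMap g.val ^ n *ᵥ x‖ ≤ r ^ n * ‖x‖ := by
  have hl := hC.lamV_pos hg
  filter_upwards [eventually_norm_pow_mulVec_le (mul_pos hr hl) h] with n hn x
  rw [coneMap, smul_pow, Matrix.smul_mulVec, norm_smul, norm_pow, norm_inv,
    Real.norm_of_nonneg hl.le, inv_pow, inv_mul_le_iff₀ (by positivity)]
  have := hn x
  rw [mul_pow] at this
  linarith

end IsCuspEnd

/-! ### Convex p-end neighborhoods -/

lemma convex_linkDomain (hΩ : Convex ℝ Ω) : Convex ℝ (linkDomain Ω : Set (Vec m i)) := by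
  rintro x ⟨hx1, hx2⟩ y ⟨hy1, hy2⟩ a b ha hb hab
  refine ⟨hΩ hx1 hy1 ha hb hab, ?_⟩
  rcases ha.eq_or_lt with rfl | ha
  · obtain rfl : b = 1 := by linarith
    simpa using hy2
  · have : 0 < a * x iO + b * y iO := by positivity
    simpa using this

lemma image_act_comm {g : Matrix (Idx m i) (Idx m i) ℝ} {f : Vec m i → Vec m i}
    (h : ∀ x, f (g *ᵥ x) = g *ᵥ f x) (hV : act g V = V) : act g (f '' V) = f '' V := by
  conv_rhs => rw [← hV]
  simp only [act, Set.image_image, h]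

lemma act_convexHull {g : Matrix (Idx m i) (Idx m i) ℝ} (hV : act g V = V) :
    act g (convexHull ℝ V) = convexHull ℝ V := by
  have h := (Matrix.mulVecLin g).image_convexHull V
  have e : (⇑(Matrix.mulVecLin g) : Vec m i → Vec m i) = fun x => g *ᵥ x := rfl
  rw [e] at h
  change (fun x => g *ᵥ x) '' (convexHull ℝ V) = _
  rw [h]
  exact congrArg _ hV

lemma IsCuspEnd.shear_mulVec (hC : IsCuspEnd G Ω) {g : GL (Idx m i) ℝ} (hg : g ∈ G) (C : ℝ)
    (x : Vec m i) : shear C (g.val *ᵥ x) = g.val *ᵥ shear C x := by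
  have hn := hC.normalizing g hg
  have h : (g.val *ᵥ x) iO = lamV g.val * x iO := by
    conv_lhs => rw [eq_ofBlocks x, mulVec_ofBlocks hn.block]
    rw [ofBlocks_iO, hn.lamV_eq hC.fiber_pos]
  rw [shear_apply, shear_apply, h, Matrix.mulVec_add, Matrix.mulVec_smul, hn.mulVec_vtx, smul_smul]
  congr 2; ring

lemma shear_cusp_mulVec (v : Fin i → ℝ) (C : ℝ) (x : Vec m i) :
    shear C (cusp v *ᵥ x) = cusp v *ᵥ shear C x := by
  rw [eq_ofBlocks x, cusp_mulVec_ofBlocks]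
  have h : ∀ κ s y t, shear C (ofBlocks κ s y t : Vec m i) =
      ofBlocks κ s y (t + C * s) := fun κ s y t => by
    rw [shear_apply]; refine vec_ext ?_ ?_ ?_ ?_ <;> simp
  rw [h, h, cusp_mulVec_ofBlocks]
  congr 1; ring

lemma IsCuspEnd.alpha7_inv (hC : IsCuspEnd G Ω) {g : GL (Idx m i) ℝ} (hg : g ∈ G) :
    alpha7 (g⁻¹).val = -alpha7 g.val := by
  have h : g.val *ᵥ ((g⁻¹).val *ᵥ (horo 0 0 0 : Vec m i)) = horo 0 0 0 := by
    rw [Matrix.mulVec_mulVec, ← Units.val_mul, mul_inv_cancel]; simp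
  rw [hC.mulVec_horo (G.inv_mem hg), Matrix.mulVec_smul, hC.mulVec_horo hg, smul_smul] at h
  have h1 := congrFun h iO
  simp only [Pi.smul_apply, smul_eq_mul, horo, ofBlocks_iO, mul_one] at h1
  rw [h1, one_smul] at h
  have := (horo_inj h).2.2
  linarith

namespace IsCuspNbhd
variable (hU : IsCuspNbhd Otilde Γ G Ω U)
include hU

lemma vtx_mem_closure_ambient : vtx ∈ closure Otilde :=
  closure_mono hU.nbhd.subset hU.nbhd.vtx_mem_closure

/-- The convex hull of `U`, pushed towards the vertex by a shear so that it is contained in `U`, is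
a convex p-end neighborhood. -/
lemma exists_convex (hC : IsCuspEnd G Ω) :
    ∃ U' : Set (Vec m i), IsCuspNbhd Otilde Γ G Ω U' ∧ Convex ℝ U' := by
  set W := convexHull ℝ U
  have hUW : U ⊆ W := subset_convexHull ℝ U
  have hWs : ∀ x ∈ W, ∀ s : ℝ, 0 < s → s • x ∈ W := fun x hx s hs =>
    convexHull_min (t := {x | s • x ∈ W}) (fun y hy => hUW (hU.nbhd.smul_mem y hy s hs))
      ((convex_convexHull ℝ U).smul_preimage s) hx
  have hWr : ∀ x ∈ W, ∀ t : ℝ, 0 ≤ t → x + t • vtx ∈ W := fun x hx t ht =>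
    convexHull_min (t := {x | x + t • vtx ∈ W}) (fun y hy => hUW (hU.nbhd.radial y hy t ht))
      ((convex_convexHull ℝ U).translate_preimage_left (t • vtx)) hx
  have hWΩ : W ⊆ linkDomain Ω :=
    convexHull_min hU.nbhd.subset_linkDomain (convex_linkDomain hC.domain.2.convex)
  have hWG : ∀ g ∈ G, act g.val W = W := fun g hg => act_convexHull (hU.nbhd.invariant g hg)
  obtain ⟨C, hsub⟩ := hC.exists_shear_subset hU.ambient hU.vtx_mem_closure_ambient hU.nbhd
    (convexHull_min hU.nbhd.subset hU.ambient.convex) hWΩ hWs hWG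
  have hsub' : shear C '' W ⊆ U := by rintro _ ⟨x, hx, rfl⟩; exact hsub x hx
  have hconv : Convex ℝ (shear C '' W) :=
    (convex_convexHull ℝ U).linear_image (shear C).toLinearEquiv.toLinearMap
  refine ⟨shear C '' W, ⟨⟨?_, ⟨?_, hconv.isPreconnected⟩, fun h => hU.nbhd.zero_notMem (hsub' h),
    ?_, hsub'.trans hU.nbhd.subset, ?_, ?_, fun g hg => ?_, fun γ hγ hγG => ?_⟩, hU.ambient,
    fun v => ?_⟩, hconv⟩
  · exact (shear C).toHomeomorph.isOpenMap _ hU.nbhd.isOpen.convexHull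
  · exact (hU.nbhd.connected.nonempty.mono hUW).image _
  · rintro _ ⟨x, hx, rfl⟩ s hs
    exact ⟨_, hWs x hx s hs, by simp⟩
  · rintro _ ⟨x, hx, rfl⟩ t ht
    exact ⟨_, hWr x hx t ht, by simp [shear_vtx]⟩
  · ext w
    constructor
    · rintro ⟨t, ht⟩
      have := hU.nbhd.subset_linkDomain (hsub' ht)
      refine ⟨?_, ?_⟩
      · have h : partK (w + t • vtx) = partK w := by
          funext a
          change w (iK a) + t * (vtx : Vec m i) (iK a) = w (iK a)
          rw [vtx_iK, mul_zero, add_zero]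
        exact h ▸ this.1
      · simpa using this.2
    · intro hw
      rw [← hU.nbhd.directions_eq] at hw
      obtain ⟨t, ht⟩ := hw
      refine ⟨t + C * w iO, _, hUW ht, ?_⟩
      rw [shear_apply, add_smul]
      simp [add_assoc]
  · exact image_act_comm (hC.shear_mulVec hg C) (hWG g hg)
  · refine (hU.nbhd.disjoint γ hγ hγG).mono (Set.image_mono hsub') hsub'
  · exact image_act_comm (shear_cusp_mulVec v C) (act_convexHull (hU.cusp_act v))

lemma isProperlyConvex (hconv : Convex ℝ U) : IsProperlyConvex U where
  nonempty := hU.nbhd.connected.nonempty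
  zero_notMem := hU.nbhd.zero_notMem
  smul_mem := hU.nbhd.smul_mem
  convex := hconv
  no_antipodal := fun x h1 h2 => hU.ambient.no_antipodal x
    (closure_mono hU.nbhd.subset h1) (closure_mono hU.nbhd.subset h2)

lemma convexOn_height (hC : IsCuspEnd G Ω) (hconv : Convex ℝ U) : ConvexOn ℝ Ω (height U) := by
  refine ⟨hC.domain.2.convex, fun x hx y hy a b ha hb hab => ?_⟩
  refine le_of_forall_pos_lt_add fun ε hε => ?_
  have h1 := (hU.horo_mem_iff x 0 (height U x + ε)).2 ⟨hx, by linarith⟩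
  have h2 := (hU.horo_mem_iff y 0 (height U y + ε)).2 ⟨hy, by linarith⟩
  have h3 := hconv h1 h2 ha hb hab
  have e : a • horo x 0 (height U x + ε) + b • horo y 0 (height U y + ε) =
      (horo (a • x + b • y) 0 (a • height U x + b • height U y + ε) : Vec m i) := by
    refine vec_ext (fun _ => ?_) ?_ (fun _ => ?_) ?_ <;> simp [horo, hab]
    linear_combination ε * hab
  rw [e, hU.horo_mem_iff] at h3
  exact h3.2

/-! ### Joins -/

/-- The height of an orbit point moves by `n α_7(g)` under the powers of `g` and `g⁻¹`. -/
lemma alpha7_eq_zero (hC : IsCuspEnd G Ω) {B : ℝ} (hB : ∀ κ ∈ Ω, height U κ ≤ B)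
    {g : GL (Idx m i) ℝ} (hg : g ∈ G) : alpha7 g.val = 0 := by
  have h : ∀ g ∈ G, alpha7 g.val ≤ 0 := fun g hg => by
    by_contra! hpos
    obtain ⟨κ, hκ⟩ := hC.domain.2.nonempty
    obtain ⟨n, hn⟩ := exists_nat_gt ((B - height U κ) / alpha7 g.val)
    rw [div_lt_iff₀ hpos] at hn
    have := hB _ (hU.coneMap_pow_mem hC hg hκ n)
    rw [hU.height_coneMap_pow hC hg hκ] at this
    linarith
  have h1 := h g hg
  have h2 := h _ (G.inv_mem hg)
  rw [hC.alpha7_inv hg] at h2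
  linarith

/-- The join `V` is not assumed to be invariant under the cusp group; it is compared with `U`. -/
lemma alpha7_eq_zero_of_isJoin (hC : IsCuspEnd G Ω) (hV : IsPEndNbhd Otilde Γ G Ω V)
    (hJ : IsJoin V) : ∀ g ∈ G, alpha7 g.val = 0 := by
  obtain ⟨A, B, -, -, rfl⟩ := hJ
  have hex : ∀ κ ∈ Ω, ∃ t, (horo κ 0 t : Vec m i) ∈ {x : Vec m i | partK x ∈ A ∧ partW x ∈ B} :=
    fun κ hκ => by
      have : (horo κ 0 0 : Vec m i) ∈ linkDomain Ω := ⟨hκ, one_pos⟩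
      rw [← hV.directions_eq] at this
      obtain ⟨t, ht⟩ := this
      exact ⟨_, (horo_add_vtx (m := m) (i := i) κ 0 0 t) ▸ ht⟩
  obtain ⟨C, hsub⟩ := hC.exists_shear_subset hU.ambient hU.vtx_mem_closure_ambient hU.nbhd
    hV.subset hV.subset_linkDomain hV.smul_mem hV.invariant
  obtain ⟨κ₀, hκ₀⟩ := hC.domain.2.nonempty
  obtain ⟨t₀, ht₀⟩ := hex κ₀ hκ₀
  refine fun g hg => hU.alpha7_eq_zero hC (B := t₀ + C) (fun κ hκ => ?_) hg
  obtain ⟨t, ht⟩ := hex κ hκ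
  have h := hsub (horo κ 0 t₀) ⟨ht.1, ht₀.2⟩
  rw [shear_horo, hU.horo_mem_iff] at h
  exact h.2.le

/-- An invariant convex height attains its maximum over a compact fundamental set, hence is constant
by the maximum principle. -/
lemma exists_height_eq (hC : IsCuspEnd G Ω) (hconv : Convex ℝ U)
    (h0 : ∀ g ∈ G, alpha7 g.val = 0) : ∃ c, ∀ κ ∈ Ω, height U κ = c := by
  obtain ⟨J, hJ, hJc, _, htr⟩ := hC.exists_transitive
  obtain ⟨κ₀, hκ₀⟩ := hC.domain.2.nonempty
  have hne : J.Nonempty := by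
    obtain ⟨g, -, z, hz, -⟩ := htr κ₀ hκ₀ 0
    exact ⟨z, hz⟩
  obtain ⟨z, hz, hmax⟩ :=
    (hU.upperSemicontinuousOn_height.mono hJ).exists_isMaxOn hne hJc
  have hmax' : ∀ κ ∈ Ω, height U κ ≤ height U z := fun κ hκ => by
    obtain ⟨g, hg, w, hw, rfl, -⟩ := htr κ hκ 0
    rw [hU.height_coneMap hC hg (hJ hw), h0 g hg, add_zero]
    exact hmax hw
  have hcv := hU.convexOn_height hC hconv
  refine ⟨height U z, fun κ hκ => le_antisymm (hmax' κ hκ) ?_⟩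
  -- prolong the segment from `κ` to `z` beyond `z`, inside `Ω`
  have hcont : Continuous fun r : ℝ => z + r • (z - κ) := by fun_prop
  obtain ⟨ε, hε, hb⟩ := Metric.isOpen_iff.1 (hC.domain.1.preimage hcont) 0
    (by simpa using hJ hz)
  have h1 : (ε / 2) ∈ Metric.ball (0 : ℝ) ε := by
    rw [Metric.mem_ball, dist_zero_right, Real.norm_of_nonneg (by positivity)]; linarith
  have h2 : z + (ε / 2) • (z - κ) ∈ Ω := hb h1
  have h3 := hcv.2 h2 hκ (by positivity : 0 ≤ 1 / (1 + ε / 2))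
    (by positivity : 0 ≤ (ε / 2) / (1 + ε / 2)) (by field_simp)
  have e : (1 / (1 + ε / 2)) • (z + (ε / 2) • (z - κ)) + ((ε / 2) / (1 + ε / 2)) • κ = z := by
    funext a
    simp
    field_simp
    ring
  rw [e] at h3
  have h4 := hmax' _ h2
  simp only [smul_eq_mul] at h3
  field_simp at h3
  nlinarith

lemma isJoin_of_height_eq (hC : IsCuspEnd G Ω) (hconv : Convex ℝ U) {c : ℝ}
    (hc : ∀ κ ∈ Ω, height U κ = c) : IsJoin U := by
  obtain ⟨κ₀, hκ₀⟩ := hC.domain.2.nonempty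
  have hmem : ∀ κ w, (Sum.elim κ w : Vec m i) ∈ U ↔
      κ ∈ Ω ∧ (Sum.elim κ₀ w : Vec m i) ∈ U := by
    have h1 : ∀ κ w, (Sum.elim κ w : Vec m i) ∈ U ↔ κ ∈ Ω ∧ 0 < w (Sum.inl ()) ∧
        c < horoHeight (Sum.elim κ₀ w : Vec m i) := fun κ w => by
      rw [hU.mem_iff]
      change 0 < w (Sum.inl ()) ∧ (w (Sum.inl ()))⁻¹ • κ ∈ Ω ∧
        height U ((w (Sum.inl ()))⁻¹ • κ) < horoHeight (Sum.elim κ₀ w : Vec m i) ↔ _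
      constructor
      · rintro ⟨h1, h2, h3⟩
        rw [hc _ h2] at h3
        exact ⟨(smul_mem_iff hC.domain.2.smul_mem (inv_pos.2 h1)).1 h2, h1, h3⟩
      · rintro ⟨h1, h2, h3⟩
        have h4 := hC.domain.2.smul_mem _ h1 _ (inv_pos.2 h2)
        exact ⟨h2, h4, (hc _ h4).symm ▸ h3⟩
    intro κ w
    rw [h1, h1 κ₀]
    exact ⟨fun h => ⟨h.1, hκ₀, h.2⟩, fun h => ⟨h.1, h.2.2⟩⟩
  have hcone : ∀ w, (Sum.elim κ₀ w : Vec m i) ∈ U → ∀ s : ℝ, 0 < s → ∀ κ ∈ Ω,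
      (Sum.elim κ (s • w) : Vec m i) ∈ U := fun w hw s hs κ hκ => by
    have h1 := hU.nbhd.smul_mem _ hw s hs
    have e : s • (Sum.elim κ₀ w : Vec m i) = Sum.elim (s • κ₀) (s • w) := by
      funext a; rcases a with a | a <;> rfl
    rw [e] at h1
    exact (hmem _ _).2 ⟨hκ, ((hmem _ _).1 h1).2⟩
  have hcont : Continuous fun p : (Fin m → ℝ) × (Unit ⊕ Fin i ⊕ Unit → ℝ) =>
      (Sum.elim p.1 p.2 : Vec m i) := by
    refine continuous_pi fun a => ?_
    rcases a with a | a
    · exact (continuous_apply a).comp continuous_fst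
    · exact (continuous_apply a).comp continuous_snd
  -- the second factor lies in the closure of `U`, over the vertex of the cone `Ω`
  have hcl : ∀ w ∈ closure {w | (Sum.elim κ₀ w : Vec m i) ∈ U},
      (Sum.elim 0 w : Vec m i) ∈ closure U := fun w hw => by
    rw [← closure_closure]
    refine map_mem_closure (f := fun w => (Sum.elim 0 w : Vec m i))
      (hcont.comp (Continuous.prodMk_right 0)) hw fun w hw => ?_
    have h0 : (0 : ℝ) ∈ closure (Set.Ioi 0) := by simp
    have h := map_mem_closure (f := fun r : ℝ => (Sum.elim (r • κ₀) w : Vec m i)) (t := U)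
      (hcont.comp ((by fun_prop : Continuous fun r : ℝ => (r • κ₀, w)))) h0 fun r hr => by
        have := hcone w hw 1 one_pos _ (hC.domain.2.smul_mem κ₀ hκ₀ r hr)
        rwa [one_smul] at this
    simpa using h
  refine ⟨Ω, {w | (Sum.elim κ₀ w : Vec m i) ∈ U}, hC.domain, ⟨?_, ?_, ?_, ?_, ?_, ?_⟩, ?_⟩
  · exact hU.nbhd.isOpen.preimage (hcont.comp (Continuous.prodMk_right κ₀))
  · exact ⟨partW (horo κ₀ 0 (c + 1) : Vec m i),
      (hU.horo_mem_iff κ₀ 0 (c + 1)).2 ⟨hκ₀, by rw [hc _ hκ₀]; linarith⟩⟩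
  · intro h
    exact lt_irrefl (0 : ℝ) (hU.nbhd.subset_linkDomain h).2
  · exact fun w hw s hs => hcone w hw s hs κ₀ hκ₀
  · intro w hw w' hw' a b ha hb hab
    have h := hconv hw hw' ha hb hab
    have e : a • (Sum.elim κ₀ w : Vec m i) + b • (Sum.elim κ₀ w' : Vec m i) =
        Sum.elim κ₀ (a • w + b • w') := by
      funext j
      rcases j with j | j
      · simp [← add_mul, hab]
      · rfl
    rwa [e] at h
  · intro w h1 h2
    have h3 := hcl _ h1
    have h4 := hcl _ h2
    have e : (Sum.elim 0 (-w) : Vec m i) = -(Sum.elim 0 w : Vec m i) := by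
      funext j; rcases j with j | j <;> simp
    rw [e] at h4
    have h5 := hU.ambient.no_antipodal _ (closure_mono hU.nbhd.subset h3)
      (closure_mono hU.nbhd.subset h4)
    exact congrArg partW h5
  · ext x
    have e : x = Sum.elim (partK x) (partW x) := by
      funext j; rcases j with j | j <;> rfl
    conv_lhs => rw [e, hmem]
    rfl

/-! ### The height near the vertex of the cone -/

lemma closure_inter_sphereK (h : Tendsto (height U) (𝓝[Ω] 0) atTop) :
    closure U ∩ sphereK m i = {x | ∃ t : ℝ, 0 < t ∧ x = t • vtx} := by
  obtain ⟨C, hCpos, hlow⟩ := hU.exists_le_height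
  ext x
  constructor
  · rintro ⟨hx, hx0, hxK⟩
    have hK : Continuous fun x : Vec m i => partK x := by unfold partK; fun_prop
    -- closed conditions satisfied on `U`
    have key : ∀ x ∈ U, 0 ≤ x iO ∧ -C * (‖partK x‖ + x iO) ≤ x iV ∧
        (fun j => x (iX j)) ⬝ᵥ (fun j => x (iX j)) / 2 ≤
          (x iV + C * (‖partK x‖ + x iO)) * x iO := by
      intro x hx
      obtain ⟨hs, hΩ, hc⟩ := (hU.mem_iff x).1 hx
      have h1 := (hlow _ hΩ).trans_lt hc
      rw [norm_smul, norm_inv, Real.norm_of_nonneg hs.le] at h1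
      set q := (fun j => x (iX j)) ⬝ᵥ (fun j => x (iX j))
      have hq : 0 ≤ q := Finset.sum_nonneg fun j _ => mul_self_nonneg _
      have e : (fun j => x (iX j) / x iO) ⬝ᵥ (fun j => x (iX j) / x iO) = q / (x iO) ^ 2 := by
        simp only [q, dotProduct, Finset.sum_div]
        refine Finset.sum_congr rfl fun j _ => ?_
        field_simp
      rw [horoHeight, e] at h1
      have h2 : q / 2 ≤ (x iV + C * (‖partK x‖ + x iO)) * x iO := by
        have h3 := mul_le_mul_of_nonneg_right h1.le (sq_nonneg (x iO))
        field_simp at h3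
        nlinarith
      refine ⟨hs.le, ?_, h2⟩
      by_contra! hneg
      nlinarith
    have hcl : IsClosed {x : Vec m i | 0 ≤ x iO ∧ -C * (‖partK x‖ + x iO) ≤ x iV ∧
        (fun j => x (iX j)) ⬝ᵥ (fun j => x (iX j)) / 2 ≤
          (x iV + C * (‖partK x‖ + x iO)) * x iO} := by
      have hq : Continuous fun x : Vec m i =>
          (fun j => x (iX j)) ⬝ᵥ (fun j => x (iX j)) / 2 := by
        unfold dotProduct; fun_prop
      have h1 : Continuous fun x : Vec m i => -C * (‖partK x‖ + x iO) := by fun_prop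
      have h2 : Continuous fun x : Vec m i => (x iV + C * (‖partK x‖ + x iO)) * x iO := by
        fun_prop
      exact (isClosed_le continuous_const (continuous_apply iO)).inter
        ((isClosed_le h1 (continuous_apply iV)).inter (isClosed_le hq h2))
    obtain ⟨hs, ht, hq⟩ := closure_minimal key hcl hx
    simp only [hxK, norm_zero, zero_add] at ht hq
    rcases hs.eq_or_lt with hs | hs
    · rw [← hs] at ht hq
      simp only [mul_zero] at ht hq
      have hq0 : 0 ≤ (fun j => x (iX j)) ⬝ᵥ (fun j => x (iX j)) :=
        Finset.sum_nonneg fun j _ => mul_self_nonneg _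
      have hy : (fun j => x (iX j)) = 0 := dotProduct_self_eq_zero.1 (by linarith)
      have e : x = x iV • vtx := by
        refine vec_ext (fun a => ?_) ?_ (fun j => ?_) ?_
        · exact (congrFun hxK a).trans (by simp)
        · simpa using hs.symm
        · simpa using congrFun hy j
        · simp
      refine ⟨x iV, lt_of_le_of_ne ht fun h0 => hx0 ?_, e⟩
      rw [e, ← h0, zero_smul]
    · exfalso
      have : (𝓝[U] x).NeBot := mem_closure_iff_nhdsWithin_neBot.1 hx
      have hO : Tendsto (fun x : Vec m i => x iO) (𝓝[U] x) (𝓝 (x iO)) :=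
        (continuous_apply iO).continuousAt.tendsto.mono_left nhdsWithin_le_nhds
      have h1 : Tendsto (fun x : Vec m i => (x iO)⁻¹ • partK x) (𝓝[U] x) (𝓝[Ω] 0) := by
        refine tendsto_nhdsWithin_iff.2 ⟨?_, ?_⟩
        · have := (hO.inv₀ hs.ne').smul
            (hK.continuousAt.tendsto.mono_left (nhdsWithin_le_nhds (s := U) (a := x)))
          rwa [hxK, smul_zero] at this
        · filter_upwards [self_mem_nhdsWithin] with x hx
          exact ((hU.mem_iff x).1 hx).2.1
      have h2 : Tendsto (horoHeight (m := m) (i := i)) (𝓝[U] x) (𝓝 (horoHeight x)) := by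
        have hcA : ∀ a : Idx m i, ContinuousAt (fun x : Vec m i => x a) x := fun a =>
          (continuous_apply a).continuousAt
        refine Tendsto.mono_left ?_ nhdsWithin_le_nhds
        unfold horoHeight dotProduct
        refine Tendsto.sub ((hcA _).div (hcA _) hs.ne') (Tendsto.div_const ?_ _)
        refine tendsto_finsetSum _ fun j _ => ?_
        exact ((hcA _).div (hcA _) hs.ne').mul ((hcA _).div (hcA _) hs.ne')
      have h3 := (h.comp h1).eventually_ge_atTop (horoHeight x + 1)
      have h4 := h2.eventually_lt_const (lt_add_one (horoHeight x))
      obtain ⟨x', h5, h6, h7⟩ := (h3.and (h4.and self_mem_nhdsWithin)).exists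
      have h8 := ((hU.mem_iff x').1 h7).2.2
      simp only [Function.comp_apply] at h5
      linarith
  · rintro ⟨t, ht, rfl⟩
    refine ⟨?_, smul_ne_zero ht.ne' vtx_ne_zero, ?_⟩
    · exact map_mem_closure (continuous_const_smul t) hU.nbhd.vtx_mem_closure
        fun y hy => hU.nbhd.smul_mem y hy t ht
    · funext a
      exact (congrArg (t * ·) (vtx_iK a)).trans (mul_zero t)

variable (hC : IsCuspEnd G Ω)
include hC

/-- Every point of a leaf is reached by an element of `G` whose three components are controlled by
the point. -/
lemma exists_controlled : ∃ C : ℝ, 0 < C ∧ ∀ κ ∈ Ω, ∀ y : Fin i → ℝ, ∃ g ∈ G,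
    (∀ w, ‖coneMap g.val *ᵥ w‖ ≤ C * ‖κ‖ * ‖w‖) ∧ ‖vecOf g.val - y‖ ≤ C ∧
      |alpha7 g.val - height U κ| ≤ C := by
  obtain ⟨J, hJ, hJc, C₁, htr⟩ := hC.exists_transitive
  obtain ⟨C₂, hC₂, hnorm⟩ := hC.exists_norm_mulVec_le hJ hJc
  obtain ⟨M, hM⟩ := (hU.upperSemicontinuousOn_height.mono hJ).bddAbove_of_isCompact hJc
  obtain ⟨C₃, hC₃, hlow⟩ := hU.exists_le_height
  obtain ⟨R, hR⟩ := hJc.isBounded.exists_norm_le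
  refine ⟨max C₂ (max C₁ (max |M| (C₃ * (R + 1)))), lt_max_of_lt_left hC₂, fun κ hκ y => ?_⟩
  obtain ⟨g, hg, z, hz, rfl, hy⟩ := htr κ hκ y
  refine ⟨g, hg, fun w => ?_, hy.trans ((le_max_left _ _).trans (le_max_right _ _)), ?_⟩
  · refine (hnorm _ (fun κ hκ => hU.coneMap_mem hC hg hκ) z hz w).trans ?_
    gcongr
    exact le_max_left _ _
  · rw [hU.height_coneMap hC hg (hJ hz), sub_add_cancel_right, abs_neg]
    refine le_trans (abs_le.2 ⟨?_, ?_⟩) ((le_max_right _ _).trans (le_max_right _ _))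
    · have h1 := hlow z (hJ hz)
      have h2 : C₃ * (‖z‖ + 1) ≤ C₃ * (R + 1) := by gcongr; exact hR z hz
      have h3 := le_max_right |M| (C₃ * (R + 1))
      linarith
    · exact (hM ⟨z, hz, rfl⟩).trans ((le_abs_self M).trans (le_max_left _ _))

/-- The elements of `G` bringing a compact set to points near the vertex of the cone contract `Ω`,
so they are in `G_+`, with `λ_2 / λ_v` as small as these points. -/
lemma tendsto_height_of_uniformPosTranslation (h : UniformPosTranslation G) :
    Tendsto (height U) (𝓝[Ω] 0) atTop := by
  obtain ⟨C₀, hC₀, hmu⟩ := h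
  obtain ⟨C, hCpos, hctl⟩ := hU.exists_controlled hC
  rw [tendsto_atTop]
  intro M
  -- `δ` is small enough for `2 * C * δ` to be less than `1`, and for its logarithm to beat `M`
  set T : ℝ := (|M| + C) / C₀ + 1
  have hT : 0 < T := by positivity
  set δ : ℝ := Real.exp (-T) / (2 * C)
  have hδ : 0 < δ := by positivity
  have hball : Metric.ball (0 : Fin m → ℝ) δ ∈ 𝓝[Ω] 0 :=
    mem_nhdsWithin_of_mem_nhds (Metric.ball_mem_nhds _ hδ)
  filter_upwards [hball, self_mem_nhdsWithin] with κ hκ hκΩ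
  rw [mem_ball_zero_iff] at hκ
  obtain ⟨g, hg, hsig, -, hα⟩ := hctl κ hκΩ 0
  have hl := hC.lamV_pos hg
  have hkp := hC.lamK_pos hg
  have h1 := hC.lamK_le hg hsig
  have h2 : 2 * (C * ‖κ‖) ≤ Real.exp (-T) := by
    have : 2 * C * ‖κ‖ ≤ 2 * C * δ := by gcongr
    have e : 2 * C * δ = Real.exp (-T) := by simp only [δ]; field_simp
    linarith
  have h3 : lamK g.val ≤ Real.exp (-T) * lamV g.val :=
    h1.trans (mul_le_mul_of_nonneg_right h2 hl.le)
  have hexp : Real.exp (-T) < 1 := by rw [Real.exp_lt_one_iff]; linarith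
  have hgp : g ∈ Gplus G := hC.mem_Gplus_iff.2 ⟨hg, by nlinarith⟩
  have h4 := hmu g hgp
  rw [hC.mu7_eq hgp, lt_div_iff₀ (hC.log_pos hgp)] at h4
  have h5 : T ≤ Real.log (lamV g.val / lamK g.val) := by
    rw [Real.le_log_iff_exp_le (by positivity), le_div_iff₀ hkp]
    calc Real.exp T * lamK g.val ≤ Real.exp T * (Real.exp (-T) * lamV g.val) := by gcongr
      _ = lamV g.val := by rw [← mul_assoc, ← Real.exp_add]; simp
  have h6 : |M| + C + C₀ = C₀ * T := by simp only [T]; field_simp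
  have h7 := mul_le_mul_of_nonneg_left h5 hC₀.le
  have h8 := (abs_le.1 hα).2
  have h9 := le_abs_self M
  linarith

/-- The p-end neighborhood `V` is not assumed to be invariant under the cusp group. -/
lemma tendsto_height_of_closure_inter (hV : IsPEndNbhd Otilde Γ G Ω V)
    (h : closure V ∩ sphereK m i = {x | ∃ t : ℝ, 0 < t ∧ x = t • vtx}) :
    Tendsto (height U) (𝓝[Ω] 0) atTop := by
  obtain ⟨C, hsub⟩ := hC.exists_shear_subset hU.ambient hU.vtx_mem_closure_ambient hV
    hU.nbhd.subset hU.nbhd.subset_linkDomain hU.nbhd.smul_mem hU.nbhd.invariant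
  rw [tendsto_atTop]
  intro M
  by_contra hcon
  have hfr : ∃ᶠ κ in 𝓝[Ω] 0, (horo κ 0 (M + C) : Vec m i) ∈ V := by
    refine ((not_eventually.1 hcon).and_eventually self_mem_nhdsWithin).mono ?_
    rintro κ ⟨h1, h2⟩
    rw [← shear_horo]
    exact hsub _ ((hU.horo_mem_iff κ 0 M).2 ⟨h2, not_le.1 h1⟩)
  have hcont : Continuous fun κ : Fin m → ℝ => (horo κ 0 (M + C) : Vec m i) := by
    refine continuous_pi fun a => ?_
    rcases a with a | a | a | a
    · exact continuous_apply a
    all_goals exact continuous_const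
  have hmem : (horo 0 0 (M + C) : Vec m i) ∈ closure V :=
    mem_closure_of_frequently_of_tendsto hfr
      (hcont.continuousAt.tendsto.mono_left nhdsWithin_le_nhds)
  have hO : (horo 0 0 (M + C) : Vec m i) iO = 1 := rfl
  have : (horo 0 0 (M + C) : Vec m i) ∈ closure V ∩ sphereK m i :=
    ⟨hmem, fun h0 => by simp [h0] at hO, rfl⟩
  rw [h] at this
  obtain ⟨t, -, ht⟩ := this
  rw [ht] at hO
  simp at hO

/-- If the height tends to infinity at the vertex of the cone `Ω`, it grows there by a definite
amount under a fixed contraction: this is clear over a compact set, and contractions commute with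
the action of `G`. -/
lemma exists_contraction (h : Tendsto (height U) (𝓝[Ω] 0) atTop) :
    ∃ δ : ℝ, 0 < δ ∧ δ < 1 ∧ ∀ κ ∈ Ω, ∀ k : ℕ, height U κ + k ≤ height U (δ ^ k • κ) := by
  obtain ⟨J, hJ, hJc, _, htr⟩ := hC.exists_transitive
  obtain ⟨M, hM⟩ := (hU.upperSemicontinuousOn_height.mono hJ).bddAbove_of_isCompact hJc
  obtain ⟨R, hR0, hR⟩ := hJc.isBounded.exists_pos_norm_le
  obtain ⟨ε, hε, hball⟩ := Metric.mem_nhdsWithin_iff.1 (h.eventually_ge_atTop (M + 1))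
  set δ : ℝ := min (1 / 2) (ε / (2 * R))
  have hδ : 0 < δ := by positivity
  have hδ1 : δ < 1 := (min_le_left _ _).trans_lt (by norm_num)
  have hsm : ∀ κ ∈ Ω, ∀ r : ℝ, 0 < r → r • κ ∈ Ω := hC.domain.2.smul_mem
  have hstep : ∀ κ ∈ Ω, height U κ + 1 ≤ height U (δ • κ) := by
    intro κ hκ
    obtain ⟨g, hg, z, hz, rfl, -⟩ := htr κ hκ 0
    have hδz := hsm z (hJ hz) δ hδ
    rw [← Matrix.mulVec_smul, hU.height_coneMap hC hg (hJ hz), hU.height_coneMap hC hg hδz]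
    have h1 : δ • z ∈ Metric.ball (0 : Fin m → ℝ) ε ∩ Ω := by
      refine ⟨?_, hδz⟩
      rw [mem_ball_zero_iff, norm_smul, Real.norm_of_nonneg hδ.le]
      calc δ * ‖z‖ ≤ (ε / (2 * R)) * R := by
            gcongr
            exacts [min_le_right _ _, hR z hz]
        _ = ε / 2 := by field_simp
        _ < ε := by linarith
    have h2 : M + 1 ≤ height U (δ • z) := hball h1
    have h3 : height U z ≤ M := hM ⟨z, hz, rfl⟩
    linarith
  refine ⟨δ, hδ, hδ1, fun κ hκ k => ?_⟩
  induction k with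
  | zero => simp
  | succ k ih =>
    have := hstep _ (hsm κ hκ _ (pow_pos hδ k))
    rw [smul_smul, ← pow_succ'] at this
    push_cast
    linarith

/-- Compare the decay of the orbit of `g`, at least exponential at any rate above `λ_2 / λ_v`, with
the growth of the height under a fixed contraction. -/
lemma uniformPosTranslation_of_tendsto (h : Tendsto (height U) (𝓝[Ω] 0) atTop) :
    UniformPosTranslation G := by
  obtain ⟨δ, hδ, hδ1, hstep⟩ := hU.exists_contraction hC h
  obtain ⟨C, hCpos, hlow⟩ := hU.exists_le_height
  set L : ℝ := -Real.log δ
  have hL : 0 < L := by have := Real.log_neg hδ hδ1; simp only [L]; linarith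
  refine ⟨1 / (2 * L), by positivity, fun g hgp => ?_⟩
  refine lt_of_lt_of_le (b := 1 / L)
    (one_div_lt_one_div_of_lt hL (by linarith)) ?_
  have hg := hgp.1
  have hl := hC.lamV_pos hg
  have hkp := hC.lamK_pos hg
  set P : ℝ := Real.log (lamV g.val / lamK g.val)
  have hP : 0 < P := hC.log_pos hgp
  rw [hC.mu7_eq hgp, le_div_iff₀ hP]
  by_contra! hcon
  obtain ⟨q, hq1, hq2⟩ := exists_between (show max (alpha7 g.val * L) 0 < P from max_lt
    (by rw [one_div_mul_eq_div, lt_div_iff₀ hL] at hcon; exact hcon) hP)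
  have hq0 : 0 < q := (le_max_right _ _).trans_lt hq1
  have hqα : alpha7 g.val < q / L := by
    rw [lt_div_iff₀ hL]; exact (le_max_left _ _).trans_lt hq1
  obtain ⟨κ₀, hκ₀⟩ := hC.domain.2.nonempty
  have hrate : lamK g.val < Real.exp (-q) * lamV g.val := by
    have h1 : Real.exp q < lamV g.val / lamK g.val :=
      (Real.lt_log_iff_exp_lt (by positivity)).1 hq2
    rw [lt_div_iff₀ hkp] at h1
    calc lamK g.val = Real.exp (-q) * (Real.exp q * lamK g.val) := by
          rw [← mul_assoc, ← Real.exp_add]; simp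
      _ < _ := by gcongr
  have hev := hC.eventually_norm_coneMap_pow_le hg (Real.exp_pos (-q)) hrate
  set K : ℝ := C * (‖κ₀‖ + 1) + 1 + height U κ₀
  obtain ⟨n₀, hn₀⟩ := exists_nat_gt (K / (q / L - alpha7 g.val))
  obtain ⟨n, hn, hnn⟩ := (hev.and (eventually_ge_atTop n₀)).exists
  -- the number of contractions that bring a point of bounded size to the size of the orbit point
  set k := ⌊(n : ℝ) * q / L⌋₊
  have hk1 : (k : ℝ) ≤ n * q / L := Nat.floor_le (by positivity)
  have hk2 : (n : ℝ) * q / L < k + 1 := Nat.lt_floor_add_one _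
  set κ' := (δ ^ k)⁻¹ • (coneMap g.val ^ n *ᵥ κ₀)
  have hκ' : κ' ∈ Ω := hC.domain.2.smul_mem _ (hU.coneMap_pow_mem hC hg hκ₀ n) _ (by positivity)
  have hnorm : ‖κ'‖ ≤ ‖κ₀‖ := by
    have h1 := hn κ₀
    simp only [κ']
    rw [norm_smul, norm_inv, Real.norm_of_nonneg (by positivity), inv_mul_le_iff₀ (by positivity)]
    refine h1.trans ?_
    gcongr
    rw [← Real.exp_nat_mul, ← Real.exp_log hδ, ← Real.exp_nat_mul, Real.exp_le_exp]
    rw [le_div_iff₀ hL] at hk1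
    simp only [L] at hk1
    linarith
  have h1 := hstep κ' hκ' k
  have e : δ ^ k • κ' = coneMap g.val ^ n *ᵥ κ₀ := by
    simp only [κ']
    rw [smul_smul, mul_inv_cancel₀ (by positivity), one_smul]
  rw [e, hU.height_coneMap_pow hC hg hκ₀] at h1
  have h2 := hlow κ' hκ'
  have h3 : C * (‖κ'‖ + 1) ≤ C * (‖κ₀‖ + 1) := by gcongr
  have h4 : (n : ℝ) * (q / L - alpha7 g.val) ≤ K := by
    have : (n : ℝ) * (q / L - alpha7 g.val) = n * q / L - n * alpha7 g.val := by ring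
    rw [this]; simp only [K]; linarith
  have h5 : 0 < q / L - alpha7 g.val := by linarith
  rw [div_lt_iff₀ h5] at hn₀
  have h6 : (n₀ : ℝ) ≤ n := by exact_mod_cast hnn
  nlinarith

/-! ### Invariant convex domains in the hemisphere -/

/-- If `α_7(g) < 0`, the orbit of a point of `D` accumulates both at the vertex and at its
antipode. -/
lemma nonnegTranslation (hD : IsProperlyConvexDomain D) (hDH : D ⊆ hemisphere m i)
    (hDG : ∀ g ∈ G, act g.val D = D) : NonnegTranslation G := by
  intro g hgp
  by_contra! hneg
  have hg := hgp.1
  obtain ⟨C, hCpos, hctl⟩ := hU.exists_controlled hC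
  obtain ⟨x, hx⟩ := hD.2.nonempty
  obtain ⟨κ, y, c, hxD⟩ : ∃ κ y c, horo κ y c ∈ D := by
    have h := hDH hx
    rw [eq_smul_horo h, smul_mem_iff hD.2.smul_mem h] at hx
    exact ⟨_, _, _, hx⟩
  obtain ⟨κ₀, hκ₀⟩ := hC.domain.2.nonempty
  set Y := Real.sqrt (y ⬝ᵥ y)
  have hrot : ∀ h ∈ G, ‖rot h.val *ᵥ y‖ ≤ Y := fun h hh => by
    refine Real.le_sqrt_of_sq_le ((norm_sq_le_dotProduct _).trans ?_)
    rw [rot_dotProduct (hC.normalizing h hh).block]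
  have horb : ∀ h ∈ G,
      horo (coneMap h.val *ᵥ κ) (vecOf h.val + rot h.val *ᵥ y) (c + alpha7 h.val) ∈ D := fun h hh =>
    (hC.horo_mem_iff_of_act hh hD.2.smul_mem (hDG h hh) κ y c).2 hxD
  have hsub : ∀ κ y c, (horo κ y c : Vec m i) - (c + y ⬝ᵥ y / 2) • vtx = ofBlocks κ 1 y 0 := by
    intro κ y c
    refine vec_ext ?_ ?_ ?_ ?_ <;> simp [horo]
  -- elements moving far along a leaf bring the orbit to the vertex
  have hpos : vtx ∈ closure D := by
    refine mem_closure_of_rays hD.2.smul_mem fun ε hε => ?_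
    set K := C * ‖κ₀‖ * ‖κ‖ + 1
    set B := |c| + |height U κ₀| + C
    set N := 4 / ε + K + ε * B
    have hK : 0 < K := by positivity
    have hB : 0 < B := by positivity
    have hN : 0 < N := by positivity
    obtain ⟨h, hh, h1, h2, h3⟩ := hctl κ₀ hκ₀
      (fun _ => N + C + Y)
    set u := vecOf h.val + rot h.val *ᵥ y
    have hu : N ≤ ‖u‖ := by
      have h4 : ‖(fun _ => N + C + Y : Fin i → ℝ)‖ = N + C + Y := by
        have : Nonempty (Fin i) := ⟨⟨0, hC.fiber_pos⟩⟩
        rw [pi_norm_const, Real.norm_of_nonneg (by positivity)]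
      have h5 : (fun _ => N + C + Y : Fin i → ℝ) =
          u - (vecOf h.val - fun _ => N + C + Y) - rot h.val *ᵥ y := by
        simp only [u]; abel
      have h6 := norm_sub_le (u - (vecOf h.val - fun _ => N + C + Y)) (rot h.val *ᵥ y)
      have h7 := norm_sub_le u (vecOf h.val - fun _ => N + C + Y)
      rw [← h5, h4] at h6
      have := hrot h hh
      linarith
    have hq := norm_sq_le_dotProduct u
    set r := c + alpha7 h.val + u ⬝ᵥ u / 2
    have hr : ‖u‖ ^ 2 / 2 - B ≤ r := by
      have h4 := (abs_le.1 h3).1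
      have h5 := neg_abs_le c
      have h6 := neg_abs_le (height U κ₀)
      simp only [r, B]; linarith
    have hNε : 4 ≤ ε * ‖u‖ := by
      calc (4 : ℝ) = ε * (4 / ε) := by field_simp
        _ ≤ ε * ‖u‖ := by
          gcongr
          refine le_trans ?_ hu
          have : 0 ≤ ε * B := by positivity
          simp only [N]; linarith
    have hfin : K + ‖u‖ ≤ ε * (‖u‖ ^ 2 / 2 - B) := by
      have h4 : K + ε * B ≤ ‖u‖ := by
        refine le_trans ?_ hu
        have : 0 < 4 / ε := by positivity
        simp only [N]; linarith
      nlinarith [norm_nonneg u]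
    have hfin' : K + ‖u‖ ≤ ε * r := hfin.trans (by gcongr)
    refine ⟨_, horb h hh, r, ?_, ?_⟩
    · have : 0 < ε * r := by linarith [norm_nonneg u]
      exact pos_of_mul_pos_right this hε.le
    · rw [hsub]
      refine (norm_ofBlocks_le _ _ _ _).trans ?_
      have := h1 κ
      rw [abs_one, abs_zero]
      simp only [K] at hfin'
      linarith
  -- elements staying near a leaf while descending by `g ^ n` bring the orbit to the antipode
  have hnegv : -vtx ∈ closure D := by
    refine mem_closure_of_rays hD.2.smul_mem fun ε hε => ?_
    have hev := hC.eventually_norm_coneMap_pow_le hg one_pos (by rw [one_mul]; exact hgp.2.2)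
    set K := C * ‖κ₀‖ * ‖κ‖ + 1 + (C + Y)
    set B := |c| + |height U κ₀| + C + (i * (C + Y) ^ 2) / 2
    have hY : 0 ≤ Y := Real.sqrt_nonneg _
    have hK : 0 < K := by positivity
    have hB : 0 < B := by positivity
    obtain ⟨n₀, hn₀⟩ := exists_nat_gt ((K / ε + B) / (-alpha7 g.val))
    obtain ⟨n, hn, hnn⟩ := (hev.and (eventually_ge_atTop n₀)).exists
    have hnB : K / ε + B < n * (-alpha7 g.val) := by
      rw [div_lt_iff₀ (by linarith)] at hn₀
      refine hn₀.trans_le ?_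
      gcongr
      linarith
    obtain ⟨h, hh, h1, h2, h3⟩ := hctl _ (hU.coneMap_pow_mem hC hg hκ₀ n) 0
    set u := vecOf h.val + rot h.val *ᵥ y
    rw [hU.height_coneMap_pow hC hg hκ₀] at h3
    rw [sub_zero] at h2
    have hu : ‖u‖ ≤ C + Y := (norm_add_le _ _).trans (add_le_add h2 (hrot h hh))
    have hq : u ⬝ᵥ u ≤ i * (C + Y) ^ 2 := by
      have h4 : ∀ j ∈ Finset.univ, u j * u j ≤ (C + Y) ^ 2 := fun j _ => by
        rw [← sq, ← sq_abs]
        gcongr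
        exact (norm_le_pi_norm u j).trans hu
      have := Finset.sum_le_card_nsmul _ _ _ h4
      simpa [dotProduct] using this
    set r := c + alpha7 h.val + u ⬝ᵥ u / 2
    have hr : K / ε ≤ -r := by
      have h4 := (abs_le.1 h3).2
      have h5 := le_abs_self c
      have h6 := le_abs_self (height U κ₀)
      simp only [r]; simp only [B] at hnB; linarith
    have hKε : 0 < K / ε := by positivity
    refine ⟨_, horb h hh, -r, by linarith, ?_⟩
    rw [neg_smul_neg, hsub]
    refine (norm_ofBlocks_le _ _ _ _).trans ?_
    have h7 := h1 κ
    have h8 : C * ‖coneMap g.val ^ n *ᵥ κ₀‖ * ‖κ‖ ≤ C * ‖κ₀‖ * ‖κ‖ := by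
      gcongr
      simpa using hn κ₀
    have h9 : K ≤ ε * -r := by
      calc K = ε * (K / ε) := by field_simp
        _ ≤ _ := by gcongr
    rw [abs_one, abs_zero]
    simp only [K] at h9
    linarith
  exact vtx_ne_zero (hD.2.no_antipodal _ hpos hnegv)

end IsCuspNbhd

end QJoin

theorem proposition4p5 (m i : ℕ) (hm : 0 < m) (hi : 0 < i)
    -- the orbifold
    (Otilde : Set (QJoin.Vec m i)) (Γ : Subgroup (GL (QJoin.Idx m i) ℝ))
    (hO : QJoin.IsProperlyConvexOrbifold Otilde Γ)
    -- the interior of `K''`, the end, and its neighborhood `U`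
    (Ω : Set (Fin m → ℝ)) (hΩ : QJoin.IsProperlyConvexDomain Ω)
    (G : Subgroup (GL (QJoin.Idx m i) ℝ)) (hGΓ : G ≤ Γ)
    (U : Set (QJoin.Vec m i)) (hU : QJoin.IsPEndNbhd Otilde Γ G Ω U)
    -- the end orbifold and `K° / G` are compact
    (hE : QJoin.CocompactOn G (QJoin.vtxLine m i) (QJoin.linkDomain Ω))
    (hK : QJoin.CocompactOn G (QJoin.vInf m i) (QJoin.linkDomain Ω))
    -- the eigenvalue condition, the matrix forms, `μ ≡ 1`, and the cusp group
    (hmec : QJoin.WeakMiddleEigenvalue G)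
    (hform : ∀ g ∈ G, QJoin.IsBlockForm g.val)
    (hmu : ∀ g ∈ G, QJoin.mu g.val = 1)
    (hnorm : ∀ g ∈ G, ∀ v : Fin i → ℝ, ∃ w : Fin i → ℝ,
      g.val * QJoin.cusp v = QJoin.cusp w * g.val)
    (hN : ∀ v : Fin i → ℝ, QJoin.act (QJoin.cusp v) U = U) :
    -- (i)
    ((∃ D : Set (QJoin.Vec m i), QJoin.IsProperlyConvexDomain D ∧ D ⊆ QJoin.hemisphere m i ∧
        ∀ g ∈ G, QJoin.act g.val D = D) → QJoin.NonnegTranslation G) ∧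
    -- (ii)
    (QJoin.UniformPosTranslation G ↔
      ∃ U' : Set (QJoin.Vec m i), QJoin.IsPEndNbhd Otilde Γ G Ω U' ∧
        QJoin.IsProperlyConvex U' ∧
        closure U' ∩ QJoin.sphereK m i = {x | ∃ t : ℝ, 0 < t ∧ x = t • QJoin.vtx}) ∧
    -- (iii)
    (Convex ℝ U → ((∀ g ∈ G, QJoin.alpha7 g.val = 0) ↔
      QJoin.IsJoin U ∧ QJoin.IsProperlyConvex U)) ∧
    ((∀ g ∈ G, QJoin.alpha7 g.val = 0) ↔
      ∃ U' : Set (QJoin.Vec m i), QJoin.IsPEndNbhd Otilde Γ G Ω U' ∧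
        QJoin.IsProperlyConvex U' ∧ QJoin.IsJoin U') := by
  have hC : QJoin.IsCuspEnd G Ω :=
    ⟨hm, hi, hΩ, hE, fun g hg => ⟨hform g hg, hmu g hg, hnorm g hg⟩⟩
  have hUc : QJoin.IsCuspNbhd Otilde Γ G Ω U := ⟨hU, hO.properlyConvex, hN⟩
  obtain ⟨U', hU', hconv'⟩ := hUc.exists_convex hC
  have hjoin : ∀ V, QJoin.IsCuspNbhd Otilde Γ G Ω V → Convex ℝ V →
      (∀ g ∈ G, QJoin.alpha7 g.val = 0) → QJoin.IsJoin V := fun V hV hconv h0 => by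
    obtain ⟨c, hc⟩ := hV.exists_height_eq hC hconv h0
    exact hV.isJoin_of_height_eq hC hconv hc
  refine ⟨?_, ⟨fun h => ?_, ?_⟩, fun hconv => ⟨fun h => ?_, fun h => ?_⟩, fun h => ?_, ?_⟩
  · rintro ⟨D, hD, hDH, hDG⟩
    exact hUc.nonnegTranslation hC hD hDH hDG
  · exact ⟨U', hU'.nbhd, hU'.isProperlyConvex hconv', hU'.closure_inter_sphereK
      (hU'.tendsto_height_of_uniformPosTranslation hC h)⟩
  · rintro ⟨V, hV, -, hcl⟩
    exact hUc.uniformPosTranslation_of_tendsto hC (hUc.tendsto_height_of_closure_inter hC hV hcl)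
  · exact ⟨hjoin U hUc hconv h, hUc.isProperlyConvex hconv⟩
  · exact hUc.alpha7_eq_zero_of_isJoin hC hU h.1
  · exact ⟨U', hU'.nbhd, hU'.isProperlyConvex hconv', hjoin U' hU' hconv' h⟩
  · rintro ⟨V, hV, -, hJ⟩
    exact hUc.alpha7_eq_zero_of_isJoin hC hV hJ
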